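/- A server stores $n$ pages; page $p$ has size $\sigma_p>0$. Requests arrive over time; a request $J$ is for one page $p$ and has an arrival time $a_J\ge 0$, and several requests may be for the same page. At each time $t$ a schedule chooses a page, a position within that page, and a speed $s(t)\ge 0$, and broadcasts the page from that position at rate $s(t)$ (preemption is allowed). In integral broadcast scheduling, a request $J$ for page $p$ is satisfied at the first time $f_J$ by which, after $a_J$, it has received the whole page $p$ from start to finish in sequential order; one broadcast serves all outstanding requests for the page that can use it. The cost of a schedule is its total flow time plus energy, $G=\sum_J (f_J-a_J)+\int_0^\infty P(s(t))\,dt$. Here $P$ is an arbitrary power function, defined on an interval $D\subseteq[0,\infty)$ of available speeds, with $0\in D$ and $D\neq\{0\}$; $P$ is continuous and differentiable on $D$, $P(0)=0$, $P$ is strictly increasing and strictly convex, and either $P$ is unbounded on $D$ or $D=[0,s_{\max}]$. With $1+\varepsilon$ resource augmentation, a schedule may broadcast at any rate $(1+\varepsilon)\gamma$ with $\gamma\in D$, and it uses power $P(\gamma)$ when it does so. An algorithm is online if its decision at each time $t$ depends only on the requests that have arrived by time $t$ (the page sizes, $P$ and $\varepsilon$ are known in advance). **Theorem.** There is an absolute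 constant $C>0$ such that for every $0<\varepsilon\le 1$, every power function $P$ as above, and all page sizes $\sigma_1,\dots,\sigma_n>0$, there is a deterministic online algorithm that, with $1+\varepsilon$ resource augmentation, is $\frac{C}{\varepsilon^3}$-competitive for total flow time plus energy in integral broadcast scheduling: on every finite collection of requests, the cost of its schedule is at most $\frac{C}{\varepsilon^3}$ times the infimum of the costs of all (offline) schedules without resource augmentation. -/

import Mathlib

open Set MeasureTheory
open scoped NNReal ENNReal

noncomputable section

/-- `P` is a power function on the interval `D ⊆ [0, ∞)` of available speeds.  The interval is
`[0, ∞)` or `[0, m)` with `P` unbounded, or `[0, m]` when there is a largest speed `m`. -/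
structure IsPowerFunction (D : Set ℝ) (P : ℝ → ℝ) : Prop where
  zero_mem : (0 : ℝ) ∈ D
  nonneg : ∀ s ∈ D, 0 ≤ s
  ordConnected : D.OrdConnected
  exists_pos : ∃ s ∈ D, 0 < s
  map_zero : P 0 = 0
  continuousOn : ContinuousOn P D
  differentiableOn : DifferentiableOn ℝ P D
  strictMonoOn : StrictMonoOn P D
  strictConvexOn : StrictConvexOn ℝ D P
  unbounded : ¬ BddAbove (P '' D) ∨ ∃ m : ℝ, D = Icc 0 m

/-- A request for one of `n` pages, with its arrival time. -/
structure Request (n : ℕ) where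
  page : Fin n
  arrival : ℝ≥0

/-- An instance is a finite collection of requests; the same page may be requested several times,
also at the same moment. -/
abbrev Instance (n : ℕ) : Type := Multiset (Request n)

/-- A broadcast schedule: at time `t` the server sends page `page t` (`none`: no page is sent)
at rate `speed t`, and the part of the page that is being sent is the one at position `pos t`
from the beginning of the page. -/
structure Schedule (n : ℕ) where
  page : ℝ → Option (Fin n)
  pos : ℝ → ℝ≥0
  speed : ℝ → ℝ≥0
  measurableSet_page : ∀ p, MeasurableSet {t | page t = some p}
  measurable_pos : Measurable pos
  measurable_speed : Measurable speed

/-- The request `r` is satisfied (integrally) by time `f`: during `[r.arrival, f]` it receives its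
whole page from start to finish, in sequential order.  Here `R` is the set of times at which
the request receives data that it uses; at each such time the position of the page that is being
sent is exactly the amount of the page which the request has received so far. -/
def Schedule.SatisfiedBy {n : ℕ} (S : Schedule n) (σ : Fin n → ℝ≥0) (r : Request n) (f : ℝ) :
    Prop :=
  ∃ R : Set ℝ, MeasurableSet R ∧ R ⊆ Icc (r.arrival : ℝ) f ∧
    (∀ t ∈ R, S.page t = some r.page) ∧
    (∀ t ∈ R, (S.pos t : ℝ≥0∞) = ∫⁻ τ in R ∩ Iic t, (S.speed τ : ℝ≥0∞)) ∧
    ∫⁻ τ in R, (S.speed τ : ℝ≥0∞) = (σ r.page : ℝ≥0∞)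

/-- The flow time of a request; it is `⊤` if the request is never satisfied. -/
def Schedule.flowTime {n : ℕ} (S : Schedule n) (σ : Fin n → ℝ≥0) (r : Request n) : ℝ≥0∞ :=
  ⨅ (f : ℝ) (_ : S.SatisfiedBy σ r f), ENNReal.ofReal (f - r.arrival)

/-- The energy used with speed advantage `κ`: sending at rate `κ * γ` uses power `P γ`. -/
def Schedule.energy {n : ℕ} (S : Schedule n) (P : ℝ → ℝ) (κ : ℝ) : ℝ≥0∞ :=
  ∫⁻ t in Ioi (0 : ℝ), ENNReal.ofReal (P (S.speed t / κ))

/-- With speed advantage `κ`, the available rates are `κ * γ` for `γ ∈ D`. -/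
def Schedule.Feasible {n : ℕ} (S : Schedule n) (D : Set ℝ) (κ : ℝ) : Prop :=
  ∀ t, (S.speed t : ℝ) / κ ∈ D

/-- Total flow time plus energy. -/
def Schedule.cost {n : ℕ} (S : Schedule n) (P : ℝ → ℝ) (κ : ℝ) (σ : Fin n → ℝ≥0)
    (I : Instance n) : ℝ≥0∞ :=
  (I.map (S.flowTime σ)).sum + S.energy P κ

/-- The optimal offline cost, without speed advantage. -/
def optCost {n : ℕ} (D : Set ℝ) (P : ℝ → ℝ) (σ : Fin n → ℝ≥0) (I : Instance n) : ℝ≥0∞ :=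
  ⨅ (S : Schedule n) (_ : S.Feasible D 1), S.cost P 1 σ I

/-- The requests that have arrived by time `t`. -/
def Instance.known {n : ℕ} (I : Instance n) (t : ℝ) : Instance n :=
  Multiset.filter (fun r => (r.arrival : ℝ) ≤ t) I

/-- A (deterministic) scheduling algorithm. -/
abbrev Algorithm (n : ℕ) : Type := Instance n → Schedule n

/-- What an online algorithm does at time `t` depends only on the requests that have arrived by
time `t`. -/
def Algorithm.IsOnline {n : ℕ} (A : Algorithm n) : Prop :=
  ∀ (I J : Instance n) (t : ℝ), I.known t = J.known t →
    (A I).page t = (A J).page t ∧ (A I).pos t = (A J).pos t ∧ (A I).speed t = (A J).speed t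

/-- With speed advantage `κ`, the algorithm `A` is `c`-competitive for total flow time plus
energy. -/
def Algorithm.IsCompetitive {n : ℕ} (A : Algorithm n) (D : Set ℝ) (P : ℝ → ℝ)
    (σ : Fin n → ℝ≥0) (κ c : ℝ) : Prop :=
  ∀ I : Instance n, (A I).Feasible D κ ∧
    (A I).cost P κ σ I ≤ ENNReal.ofReal c * optCost D P σ I

end

/-! The online algorithm simulates a fractional schedule and replays it integrally with a small
extra speed. Let `γ k = speedOf D P k` be the largest speed of power at most `k`. With `k` alive
requests, the fractional schedule runs at speed `(1 + ε/3) * γ k` and divides it equally among the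
latest fraction `β = ε/8` of them; a request is completed once its page has been sent in the amount
of its size since its arrival, in any order.

Fractional bound (`flow_le`, `lintegral_power_le`, `fractional_flow_le`). Let `X` be the fractional
flow, and `F`, `En` the flow and energy of a competitor. At time `t`, unless the competitor has many
unsatisfied requests, most late requests `i` are already satisfied by it, so it has sent the whole
page during `[a i, t]`. The processing of `i` at `t`, weighted by `rank / γ rank`, is charged to the
times `u` at which the competitor sent that page. The weight only grows when `t` is replaced by `u`,
and the requests for one page alive at `u` have at most one page size of processing still due to
them. Hence the charge at `u` is at most (competitor's speed) `* k / γ k`, which convexity bounds by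
`k + P(speed)` (`mul_div_speedOf_le`). In all, `κ(1-β) X ≤ (κ(1-β)/β) F + X + En` with `κ(1-β) ≥ 1 +
ε/6`, so `X ≤ (64/ε²)(F + En)`.

Rounding (`exists_served`, `received_of_le_served`, `lintegral_speed_le`). Viewed at speed `1 + ε`,
the fractional schedule gives page `p` a share of time, and the shares add up to at most `lam = (1 +
ε/3)/(1 + ε) < 1`. The integral of the share is the clock of the page. After request `i` is
completed fractionally, the piece of the clock between `a i` and `b i` is replayed contiguously on
that clock; it carries exactly one page, and all requests that arrived by `b i` can use it. Requests
of least fractional flow go first, and no clock is ever turned back. So the replay uses no more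
energy than the fractional schedule, and a busy-period argument bounds the flow of each request by
`1/(1 - lam) ≤ 3/ε` times its fractional flow. Fractional energy at speed `γ k` is at most `k` per
unit of time, hence at most `X` in all. The total is `(3/ε + 1) X ≤ (4/ε)(64/ε²)(F + En)`.

Online-ness (`IsCompletion.eq_of_le`, `Agree.replaySchedule_eq`): completion times up to `T` are
determined by the arrivals up to `T`, and the replay at `T` reads nothing later. -/

noncomputable section

namespace Broadcast

/-! ### Measurability of functions of a time-dependent finite set -/

/-- The filtered set takes finitely many values, each on a finite intersection of measurable sets,
so `F` may be arbitrary. -/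
theorem measurable_comp_filter {ι β : Type*} [MeasurableSpace β] (E : Finset ι)
    (J : ℝ → ι → Prop) [∀ t, DecidablePred (J t)] (hJ : ∀ i, MeasurableSet {t | J t i})
    (F : Finset ι → β) : Measurable fun t => F (E.filter (J t)) := by
  classical
  intro s _
  have key : ∀ A : Finset ι, MeasurableSet {t | E.filter (J t) = A} := by
    intro A
    have : {t | E.filter (J t) = A} =
        if A ⊆ E then ⋂ i ∈ E, (if i ∈ A then {t | J t i} else {t | J t i}ᶜ) else ∅ := by
      ext t
      split_ifs with hA
      · simp only [mem_ofPred_eq, mem_iInter]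
        constructor
        · rintro rfl i hi
          by_cases h : J t i <;> simp [h, hi]
        · intro h
          ext i
          simp only [Finset.mem_filter]
          constructor
          · rintro ⟨hi, ht⟩
            have := h i hi
            by_contra hc
            simp only [hc, if_false] at this
            exact this ht
          · intro hi
            have := h i (hA hi)
            simp only [hi, if_true] at this
            exact ⟨hA hi, this⟩
      · simp only [mem_ofPred_eq, mem_empty_iff_false, iff_false]
        rintro rfl
        exact hA (Finset.filter_subset _ _)
    rw [this]
    split_ifs
    · refine Finset.measurableSet_biInter _ fun i _ => ?_
      split_ifs
      · exact hJ i
      · exact (hJ i).compl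
    · exact MeasurableSet.empty
  have : (fun t => F (E.filter (J t))) ⁻¹' s =
      ⋃ A ∈ E.powerset.filter (fun A => F A ∈ s), {t | E.filter (J t) = A} := by
    ext t
    simp
  rw [this]
  exact Finset.measurableSet_biUnion _ fun A _ => key A

theorem intervalIntegrable_comp_filter {ι : Type*} (E : Finset ι) (J : ℝ → ι → Prop)
    [∀ t, DecidablePred (J t)] (hJ : ∀ i, MeasurableSet {t | J t i}) (F : Finset ι → ℝ) (x y : ℝ) :
    IntervalIntegrable (fun t => F (E.filter (J t))) volume x y := by
  refine (intervalIntegrable_const (c := ∑ A ∈ E.powerset, |F A|)).mono_fun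
    (measurable_comp_filter E J hJ F).aestronglyMeasurable (Filter.Eventually.of_forall fun t => ?_)
  refine le_trans ?_ (le_abs_self _)
  exact Finset.single_le_sum (f := fun A => |F A|) (fun A _ => abs_nonneg _)
    (Finset.mem_powerset.2 (Finset.filter_subset _ _))

/-! ### Existence and causality of the fractional completion times -/

section Completion

variable {ι : Type*} {n : ℕ}

open Classical in
/-- The requests of `E` that have arrived by time `t` and are not completed by time `t`. -/
def alive (a : ι → ℝ) (E : Finset ι) (b : ι → ℝ) (t : ℝ) : Finset ι :=
  E.filter fun i => a i ≤ t ∧ t < b i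

open Classical in
/-- The alive requests when those in `U` are never completed. -/
def aliveWith (a : ι → ℝ) (E U : Finset ι) (b : ι → ℝ) (t : ℝ) : Finset ι :=
  E.filter fun i => a i ≤ t ∧ (i ∈ U ∨ t < b i)

/-- `b` is the vector of completion times of the fractional schedule that sends page `p` at rate
`rate A p` when the set of alive requests is `A`. -/
def IsCompletion (a : ι → ℝ) (pg : ι → Fin n) (σ : Fin n → ℝ) (rate : Finset ι → Fin n → ℝ)
    (E : Finset ι) (b : ι → ℝ) : Prop :=
  ∀ i ∈ E, a i < b i ∧ (∫ t in (a i)..(b i), rate (alive a E b t) (pg i)) = σ (pg i) ∧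
    ∀ t, a i ≤ t → t < b i → (∫ u in (a i)..t, rate (alive a E b u) (pg i)) < σ (pg i)

theorem mem_alive {a : ι → ℝ} {E : Finset ι} {b : ι → ℝ} {t : ℝ} {i : ι} :
    i ∈ alive a E b t ↔ i ∈ E ∧ a i ≤ t ∧ t < b i := by
  simp [alive]

theorem measurable_alive {β : Type*} [MeasurableSpace β] (a : ι → ℝ) (E : Finset ι) (b : ι → ℝ)
    (F : Finset ι → β) : Measurable fun t => F (alive a E b t) :=
  measurable_comp_filter E (fun t i => a i ≤ t ∧ t < b i) (fun _ => measurableSet_Ico) F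

theorem intervalIntegrable_alive (a : ι → ℝ) (E : Finset ι) (b : ι → ℝ)
    (F : Finset ι → ℝ) (x y : ℝ) : IntervalIntegrable (fun t => F (alive a E b t)) volume x y :=
  intervalIntegrable_comp_filter E (fun t i => a i ≤ t ∧ t < b i) (fun _ => measurableSet_Ico) F x y

open Classical in
theorem intervalIntegrable_aliveWith (a : ι → ℝ) (E U : Finset ι) (b : ι → ℝ)
    (F : Finset ι → ℝ) (x y : ℝ) :
    IntervalIntegrable (fun t => F (aliveWith a E U b t)) volume x y := by
  refine intervalIntegrable_comp_filter E (fun t i => a i ≤ t ∧ (i ∈ U ∨ t < b i))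
    (fun i => ?_) F x y
  refine measurableSet_Ici.inter (MeasurableSet.union ?_ measurableSet_Iio)
  exact MeasurableSet.const _

theorem aliveWith_empty (a : ι → ℝ) (E : Finset ι) (b : ι → ℝ) (t : ℝ) :
    aliveWith a E ∅ b t = alive a E b t := by
  simp [aliveWith, alive]

open Classical in
theorem integral_congr_lt {f g : ℝ → ℝ} {x y T : ℝ} (hxy : x ≤ y) (hy : y ≤ T)
    (h : ∀ t < T, f t = g t) : ∫ t in x..y, f t = ∫ t in x..y, g t := by
  rw [intervalIntegral.integral_of_le hxy, intervalIntegral.integral_of_le hxy,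
    integral_Ioc_eq_integral_Ioo, integral_Ioc_eq_integral_Ioo]
  exact setIntegral_congr_fun measurableSet_Ioo fun t ht => h t (ht.2.trans_le hy)

open Classical in
/-- One more completion. -/
theorem exists_completion_step (a : ι → ℝ) (pg : ι → Fin n) (σ : Fin n → ℝ)
    (hσ : ∀ p, 0 < σ p) (rate : Finset ι → Fin n → ℝ) (h0 : ∀ A p, 0 ≤ rate A p)
    (hpos : ∀ A : Finset ι, A.Nonempty → ∃ i ∈ A, 0 < rate A (pg i)) (E : Finset ι)
    (U : Finset ι) (hU : U ⊆ E) (hne : U.Nonempty) (b : ι → ℝ) (T : ℝ)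
    (h1 : ∀ i ∈ E, i ∉ U → a i < b i ∧ b i ≤ T ∧
      (∫ t in (a i)..(b i), rate (aliveWith a E U b t) (pg i)) = σ (pg i) ∧
      ∀ t, a i ≤ t → t < b i → (∫ u in (a i)..t, rate (aliveWith a E U b u) (pg i)) < σ (pg i))
    (h2 : ∀ i ∈ U, ∀ t, a i ≤ t → t < T →
      (∫ u in (a i)..t, rate (aliveWith a E U b u) (pg i)) < σ (pg i)) :
    ∃ i ∈ U, ∃ b' : ι → ℝ, ∃ T' : ℝ,
    (∀ j ∈ E, j ∉ U.erase i → a j < b' j ∧ b' j ≤ T' ∧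
      (∫ t in (a j)..(b' j), rate (aliveWith a E (U.erase i) b' t) (pg j)) = σ (pg j) ∧
      ∀ t, a j ≤ t → t < b' j →
        (∫ u in (a j)..t, rate (aliveWith a E (U.erase i) b' u) (pg j)) < σ (pg j)) ∧
    (∀ j ∈ U.erase i, ∀ t, a j ≤ t → t < T' →
      (∫ u in (a j)..t, rate (aliveWith a E (U.erase i) b' u) (pg j)) < σ (pg j)) := by
  set f : ι → ℝ → ℝ := fun i t => ∫ u in (a i)..t, rate (aliveWith a E U b u) (pg i) with hf
  have hint : ∀ p x y, IntervalIntegrable (fun u => rate (aliveWith a E U b u) p) volume x y :=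
    fun p x y => intervalIntegrable_aliveWith a E U b (fun A => rate A p) x y
  have hcont : ∀ i, Continuous (f i) := fun i =>
    intervalIntegral.continuous_primitive (fun x y => hint (pg i) x y) (a i)
  -- The next completion is the infimum of the times at which some request of `U` has received its
  -- page, computed as if nothing in `U` ever completed.
  set S : Set ℝ := ⋃ i ∈ U, {t | a i ≤ t ∧ σ (pg i) ≤ f i t} with hS
  have hSc : IsClosed S := by
    refine isClosed_biUnion_finset fun i _ => ?_
    exact isClosed_Ici.inter (isClosed_le continuous_const (hcont i))
  have hSb : BddBelow S := by
    refine ⟨U.inf' hne a, ?_⟩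
    intro t ht
    simp only [hS, mem_iUnion, mem_ofPred_eq] at ht
    obtain ⟨i, hi, h, _⟩ := ht
    exact (Finset.inf'_le a hi).trans h
  have hSn : S.Nonempty := by
    -- From `T0` on, the alive set is constantly `U`, so a page of positive rate accumulates its
    -- size within a further `σ / rate`.
    obtain ⟨i, hi, hr⟩ := hpos U hne
    set T0 : ℝ := max T (U.sup' hne a)
    set M : ℝ := T0 + σ (pg i) / rate U (pg i)
    have hM : T0 ≤ M := le_add_of_nonneg_right (div_nonneg (hσ _).le hr.le)
    have haT : a i ≤ T0 := (Finset.le_sup' a hi).trans (le_max_right _ _)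
    have hal : ∀ t, T0 ≤ t → aliveWith a E U b t = U := by
      intro t ht
      ext j
      simp only [aliveWith, Finset.mem_filter]
      constructor
      · rintro ⟨hj, -, h | h⟩
        · exact h
        · by_contra hjU
          have := (h1 j hj hjU).2.1
          have := le_max_left T (U.sup' hne a)
          linarith
      · intro hj
        exact ⟨hU hj, ((Finset.le_sup' a hj).trans (le_max_right _ _)).trans ht, Or.inl hj⟩
    refine ⟨M, ?_⟩
    simp only [hS, mem_iUnion, mem_ofPred_eq]
    refine ⟨i, hi, haT.trans hM, ?_⟩
    have e1 : f i M = f i T0 + ∫ u in T0..M, rate (aliveWith a E U b u) (pg i) :=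
      (intervalIntegral.integral_add_adjacent_intervals (hint _ _ _) (hint _ _ _)).symm
    have e2 : (∫ u in T0..M, rate (aliveWith a E U b u) (pg i)) = σ (pg i) := by
      rw [intervalIntegral.integral_congr (g := fun _ => rate U (pg i))]
      · rw [intervalIntegral.integral_const, smul_eq_mul]
        simp only [M]
        field_simp
        ring
      · intro u hu
        rw [uIcc_of_le hM] at hu
        simp only [hal u hu.1]
    have e3 : 0 ≤ f i T0 := intervalIntegral.integral_nonneg haT fun u _ => h0 _ _
    linarith
  set τ := sInf S with hτ
  have hτS : τ ∈ S := hSc.csInf_mem hSn hSb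
  have hlt : ∀ i ∈ U, ∀ t, a i ≤ t → t < τ → f i t < σ (pg i) := by
    intro i hi t h3 h4
    by_contra hc
    have : t ∈ S := by
      simp only [hS, mem_iUnion, mem_ofPred_eq]
      exact ⟨i, hi, h3, not_lt.1 hc⟩
    exact absurd (csInf_le hSb this) (not_le.2 h4)
  obtain ⟨i, hi, hai, hfi⟩ : ∃ i ∈ U, a i ≤ τ ∧ σ (pg i) ≤ f i τ := by
    simpa only [hS, mem_iUnion, mem_ofPred_eq, exists_prop] using hτS
  have hTτ : T ≤ τ := by
    by_contra hc
    exact absurd (h2 i hi τ hai (not_le.1 hc)) (not_lt.2 hfi)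
  have hai' : a i < τ := by
    rcases hai.lt_or_eq with h | h
    · exact h
    · exfalso
      have : f i τ = 0 := by simp only [hf, ← h, intervalIntegral.integral_same]
      linarith [hσ (pg i)]
  have hfi' : f i τ = σ (pg i) := by
    refine le_antisymm ?_ hfi
    have : Filter.Tendsto (f i) (nhdsWithin τ (Iio τ)) (nhds (f i τ)) :=
      ((hcont i).tendsto τ).mono_left nhdsWithin_le_nhds
    refine le_of_tendsto this ?_
    filter_upwards [Ioo_mem_nhdsLT hai'] with t ht
    exact (hlt i hi t ht.1.le ht.2).le
  refine ⟨i, hi, Function.update b i τ, τ, ?_⟩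
  -- Fixing the completion of `i` at `τ` changes no alive set before `τ`, so every integral up to
  -- `τ` is kept.
  have hal : ∀ t < τ, aliveWith a E (U.erase i) (Function.update b i τ) t = aliveWith a E U b t := by
    intro t ht
    ext j
    simp only [aliveWith, Finset.mem_filter, Finset.mem_erase]
    by_cases hj : j = i
    · subst hj
      simp [ht, hi]
    · simp [hj]
  have hcg : ∀ j t, a j ≤ t → t ≤ τ →
      (∫ u in (a j)..t, rate (aliveWith a E (U.erase i) (Function.update b i τ) u) (pg j)) =
        f j t := by
    intro j t h3 h4
    exact integral_congr_lt h3 h4 fun u hu => by rw [hal u hu]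
  constructor
  · intro j hj hjU
    by_cases hji : j = i
    · subst hji
      simp only [Function.update_self]
      refine ⟨hai', le_rfl, ?_, ?_⟩
      · rw [hcg j τ hai le_rfl, hfi']
      · intro t h3 h4
        rw [hcg j t h3 h4.le]
        exact hlt j hi t h3 h4
    · have hjU' : j ∉ U := fun h => hjU (Finset.mem_erase.2 ⟨hji, h⟩)
      obtain ⟨g1, g2, g3, g4⟩ := h1 j hj hjU'
      rw [Function.update_of_ne hji]
      refine ⟨g1, g2.trans hTτ, ?_, ?_⟩
      · rw [hcg j _ g1.le (g2.trans hTτ)]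
        exact g3
      · intro t h3 h4
        rw [hcg j t h3 (h4.le.trans (g2.trans hTτ))]
        exact g4 t h3 h4
  · intro j hj t h3 h4
    rw [hcg j t h3 h4.le]
    exact hlt j (Finset.mem_of_mem_erase hj) t h3 h4

-- The completion times solve a fixed-point condition, since the rates depend on which requests are
-- complete. They are found in chronological order: `U` is the set not yet completed, and loses one
-- element per step.
open Classical in
theorem exists_isCompletion (a : ι → ℝ) (pg : ι → Fin n) (σ : Fin n → ℝ)
    (hσ : ∀ p, 0 < σ p) (rate : Finset ι → Fin n → ℝ) (h0 : ∀ A p, 0 ≤ rate A p)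
    (hpos : ∀ A : Finset ι, A.Nonempty → ∃ i ∈ A, 0 < rate A (pg i)) (E : Finset ι) :
    ∃ b, IsCompletion a pg σ rate E b := by
  have key : ∀ k, k ≤ E.card → ∃ U : Finset ι, U ⊆ E ∧ U.card + k = E.card ∧
      ∃ b : ι → ℝ, ∃ T : ℝ, (∀ i ∈ E, i ∉ U → a i < b i ∧ b i ≤ T ∧
      (∫ t in (a i)..(b i), rate (aliveWith a E U b t) (pg i)) = σ (pg i) ∧
      ∀ t, a i ≤ t → t < b i → (∫ u in (a i)..t, rate (aliveWith a E U b u) (pg i)) < σ (pg i)) ∧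
      (∀ i ∈ U, ∀ t, a i ≤ t → t < T →
      (∫ u in (a i)..t, rate (aliveWith a E U b u) (pg i)) < σ (pg i)) := by
    intro k
    induction k with
    | zero =>
      intro _
      rcases E.eq_empty_or_nonempty with rfl | hne
      · exact ⟨∅, by simp, by simp, 0, 0, by simp, by simp⟩
      -- With `T` the first arrival, the condition on times before `T` is vacuous.
      refine ⟨E, subset_rfl, by simp, 0, E.inf' hne a, fun i hi h => absurd hi h, ?_⟩
      intro i hi t h3 h4
      exact absurd (Finset.inf'_le a hi) (not_le.2 (h3.trans_lt h4))
    | succ k ih =>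
      intro hk
      obtain ⟨U, hU, hc, b, T, h1, h2⟩ := ih (by omega)
      have hne : U.Nonempty := Finset.card_pos.1 (by omega)
      obtain ⟨i, hi, b', T', h3, h4⟩ :=
        exists_completion_step a pg σ hσ rate h0 hpos E U hU hne b T h1 h2
      refine ⟨U.erase i, (Finset.erase_subset _ _).trans hU, ?_, b', T', h3, h4⟩
      rw [Finset.card_erase_of_mem hi]
      have := Finset.card_pos.2 hne
      omega
  obtain ⟨U, -, hc, b, T, h1, -⟩ := key E.card le_rfl
  have : U = ∅ := Finset.card_eq_zero.1 (by omega)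
  subst this
  refine ⟨b, fun i hi => ?_⟩
  obtain ⟨g1, -, g3, g4⟩ := h1 i hi (by simp)
  simp only [aliveWith_empty] at g3 g4
  exact ⟨g1, g3, g4⟩

open Classical in
/-- The completion times up to `T` depend only on the requests that arrive by time `T`. -/
theorem IsCompletion.eq_of_le {a : ι → ℝ} {pg : ι → Fin n} {σ : Fin n → ℝ}
    {rate : Finset ι → Fin n → ℝ} {E E' : Finset ι} {b b' : ι → ℝ} {T : ℝ}
    (h : IsCompletion a pg σ rate E b) (h' : IsCompletion a pg σ rate E' b')
    (hE : ∀ i, a i ≤ T → (i ∈ E ↔ i ∈ E')) :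
    ∀ i ∈ E, a i ≤ T → (b i ≤ T ∨ b' i ≤ T) → b i = b' i := by
  by_contra! hc
  obtain ⟨i₀, hi₀, ha₀, hb₀, hne₀⟩ := hc
  set B := E.filter fun i => a i ≤ T ∧ (b i ≤ T ∨ b' i ≤ T) ∧ b i ≠ b' i with hB
  -- At the earliest discrepancy `m`, the alive sets still agree before `m`, so request `i` has
  -- received the same amount in both schedules; one of them has completed it at `m` and the other
  -- has not.
  obtain ⟨i, hiB, hmin⟩ := B.exists_min_image (fun i => min (b i) (b' i))
    ⟨i₀, by simp only [hB, Finset.mem_filter]; exact ⟨hi₀, ha₀, hb₀, hne₀⟩⟩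
  simp only [hB, Finset.mem_filter] at hiB hmin
  obtain ⟨hiE, hia, hib, hine⟩ := hiB
  set m := min (b i) (b' i) with hm
  have hmT : m ≤ T := min_le_iff.2 hib
  have hal : ∀ t < m, alive a E b t = alive a E' b' t := by
    intro t ht
    ext j
    rw [mem_alive, mem_alive]
    by_cases hj : a j ≤ t
    · have hjT : a j ≤ T := hj.trans (ht.le.trans hmT)
      rw [hE j hjT]
      simp only [hj, true_and]
      refine and_congr_right fun hjE => ?_
      by_cases hjb : b j = b' j
      · rw [hjb]
      · by_cases hjc : b j ≤ T ∨ b' j ≤ T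
        · have := hmin j ⟨(hE j hjT).2 hjE, hjT, hjc, hjb⟩
          have h2 := lt_min_iff.1 (ht.trans_le this)
          simp [h2.1, h2.2]
        · rw [not_or, not_le, not_le] at hjc
          have : t < T := ht.trans_le hmT
          simp [this.trans hjc.1, this.trans hjc.2]
    · simp [hj]
  obtain ⟨g1, g2, g3⟩ := h i hiE
  obtain ⟨g1', g2', g3'⟩ := h' i ((hE i hia).1 hiE)
  have ham : a i ≤ m := (lt_min g1 g1').le
  have hcg := integral_congr_lt (f := fun u => rate (alive a E b u) (pg i))
    (g := fun u => rate (alive a E' b' u) (pg i)) ham le_rfl fun u hu => by rw [hal u hu]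
  rcases lt_or_gt_of_ne hine with hlt | hlt
  · have : m = b i := min_eq_left hlt.le
    rw [this] at hcg ham
    have := g3' _ ham hlt
    linarith
  · have : m = b' i := min_eq_right hlt.le
    rw [this] at hcg ham
    have := g3 _ ham hlt
    linarith

end Completion

/-! ### Speed as a function of the number of alive requests -/

section Power

variable {D : Set ℝ} {P : ℝ → ℝ}

theorem mul_mem (hP : IsPowerFunction D P) {s t : ℝ} (hs : s ∈ D) (h0 : 0 ≤ t) (h1 : t ≤ 1) :
    t * s ∈ D :=
  hP.ordConnected.out hP.zero_mem hs
    ⟨mul_nonneg h0 (hP.nonneg s hs), mul_le_of_le_one_left (hP.nonneg s hs) h1⟩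

theorem power_mul_le (hP : IsPowerFunction D P) {s t : ℝ} (hs : s ∈ D) (h0 : 0 ≤ t) (h1 : t ≤ 1) :
    P (t * s) ≤ t * P s := by
  have := hP.strictConvexOn.convexOn.2 hs hP.zero_mem h0 (sub_nonneg.2 h1) (by ring)
  simpa [hP.map_zero] using this

theorem power_nonneg (hP : IsPowerFunction D P) {s : ℝ} (hs : s ∈ D) : 0 ≤ P s := by
  have := hP.strictMonoOn.monotoneOn hP.zero_mem hs (hP.nonneg s hs)
  rwa [hP.map_zero] at this

/-- The largest available speed of power at most `k`. -/
def speedOf (D : Set ℝ) (P : ℝ → ℝ) (k : ℕ) : ℝ := sSup {s ∈ D | P s ≤ k}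

/-- The maximum is attained by compactness: the admissible speeds lie below a speed of power greater
than `k` if `P` is unbounded, and below the largest speed otherwise. -/
theorem isGreatest_speedOf (hP : IsPowerFunction D P) (k : ℕ) :
    IsGreatest {s ∈ D | P s ≤ k} (speedOf D P k) := by
  obtain ⟨m, hm, hle⟩ : ∃ m ∈ D, ∀ s ∈ D, P s ≤ k → s ≤ m := by
    rcases hP.unbounded with h | ⟨m, hm⟩
    · rw [not_bddAbove_iff] at h
      obtain ⟨_, ⟨m, hm, rfl⟩, hk⟩ := h k
      exact ⟨m, hm, fun s hs hsk => (hP.strictMonoOn.le_iff_le hs hm).1 (hsk.trans hk.le)⟩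
    · obtain ⟨s, hs, h0⟩ := hP.exists_pos
      have h1 : s ∈ Icc 0 m := hm ▸ hs
      exact ⟨m, hm ▸ ⟨h1.1.trans h1.2, le_rfl⟩, fun s hs _ => (hm ▸ hs : s ∈ Icc 0 m).2⟩
  have hsub : Icc 0 m ⊆ D := hP.ordConnected.out hP.zero_mem hm
  have heq : {s ∈ D | P s ≤ k} = {s ∈ Icc 0 m | P s ≤ k} := by
    ext s
    constructor
    · rintro ⟨hs, hk⟩
      exact ⟨⟨hP.nonneg s hs, hle s hs hk⟩, hk⟩
    · rintro ⟨hs, hk⟩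
      exact ⟨hsub hs, hk⟩
  have hc : IsCompact {s ∈ D | P s ≤ k} := by
    rw [heq]
    refine isCompact_Icc.of_isClosed_subset ?_ (fun s hs => hs.1)
    exact (hP.continuousOn.mono hsub).preimage_isClosed_of_isClosed isClosed_Icc isClosed_Iic
  exact hc.isGreatest_sSup ⟨0, hP.zero_mem, by simp [hP.map_zero]⟩

theorem speedOf_mem (hP : IsPowerFunction D P) (k : ℕ) : speedOf D P k ∈ D :=
  (isGreatest_speedOf hP k).1.1

theorem power_speedOf_le (hP : IsPowerFunction D P) (k : ℕ) : P (speedOf D P k) ≤ k :=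
  (isGreatest_speedOf hP k).1.2

theorem le_speedOf (hP : IsPowerFunction D P) {k : ℕ} {s : ℝ} (hs : s ∈ D) (h : P s ≤ k) :
    s ≤ speedOf D P k :=
  (isGreatest_speedOf hP k).2 ⟨hs, h⟩

theorem speedOf_nonneg (hP : IsPowerFunction D P) (k : ℕ) : 0 ≤ speedOf D P k :=
  hP.nonneg _ (speedOf_mem hP k)

theorem speedOf_mono (hP : IsPowerFunction D P) : Monotone (speedOf D P) := fun j k h =>
  le_speedOf hP (speedOf_mem hP j) ((power_speedOf_le hP j).trans (by exact_mod_cast h))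

theorem speedOf_pos (hP : IsPowerFunction D P) {k : ℕ} (hk : 1 ≤ k) : 0 < speedOf D P k := by
  obtain ⟨s, hs, h0⟩ := hP.exists_pos
  have hPs := power_nonneg hP hs
  have hk' : (1 : ℝ) ≤ k := by exact_mod_cast hk
  have h1 : 0 < 1 / (1 + P s) := by positivity
  have h2 : 1 / (1 + P s) ≤ 1 := by
    rw [div_le_one (by positivity)]
    linarith
  have h3 : 1 / (1 + P s) * s ≤ speedOf D P k := by
    refine le_speedOf hP (mul_mem hP hs h1.le h2) ((power_mul_le hP hs h1.le h2).trans ?_)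
    refine le_trans ?_ hk'
    rw [one_div_mul_eq_div, div_le_one (by positivity)]
    linarith
  exact (mul_pos h1 h0).trans_le h3

/-- By convexity and `P 0 = 0`, slowing `speedOf D P k` down by the factor `j / k` brings its power
to at most `j`. -/
theorem div_speedOf_mono (hP : IsPowerFunction D P) {j k : ℕ} (hj : 1 ≤ j) (hjk : j ≤ k) :
    (j : ℝ) / speedOf D P j ≤ k / speedOf D P k := by
  have hj0 : (0 : ℝ) < j := by exact_mod_cast hj
  have hk0 : (0 : ℝ) < k := by exact_mod_cast hj.trans hjk
  rw [div_le_div_iff₀ (speedOf_pos hP hj) (speedOf_pos hP (hj.trans hjk))]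
  have h1 : (j : ℝ) / k ≤ 1 := by
    rw [div_le_one hk0]
    exact_mod_cast hjk
  have h0 : 0 ≤ (j : ℝ) / k := by positivity
  have : (j : ℝ) / k * speedOf D P k ≤ speedOf D P j := by
    refine le_speedOf hP (mul_mem hP (speedOf_mem hP k) h0 h1)
      ((power_mul_le hP (speedOf_mem hP k) h0 h1).trans ?_)
    calc (j : ℝ) / k * P (speedOf D P k) ≤ j / k * k := by
          gcongr
          exact power_speedOf_le hP k
      _ = j := by field_simp
  rw [div_mul_eq_mul_div, div_le_iff₀ hk0] at this
  linarith

/-- A Young-type inequality: up to `speedOf D P k` the left side is at most `k`; beyond it,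
convexity gives `k / speedOf D P k ≤ P s / s`. It splits the competitor's work into flow of the
algorithm and energy of the competitor. -/
theorem mul_div_speedOf_le (hP : IsPowerFunction D P) (k : ℕ) {s : ℝ} (hs : s ∈ D) :
    s * (k / speedOf D P k) ≤ k + P s := by
  have hPs := power_nonneg hP hs
  rcases Nat.eq_zero_or_pos k with rfl | hk
  · simpa using hPs
  have hg := speedOf_pos hP hk
  rw [mul_div_assoc', div_le_iff₀ hg]
  rcases le_or_gt s (speedOf D P k) with h | h
  · nlinarith [mul_nonneg (Nat.cast_nonneg (α := ℝ) k) (sub_nonneg.2 h), mul_nonneg hPs hg.le]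
  · have hk' : (k : ℝ) < P s := by
      by_contra hc
      exact absurd (le_speedOf hP hs (not_lt.1 hc)) (not_le.2 h)
    have hPs' : 0 < P s := (Nat.cast_nonneg k).trans_lt hk'
    have h1 : (k : ℝ) / P s ≤ 1 := (div_le_one hPs').2 hk'.le
    have h0 : 0 ≤ (k : ℝ) / P s := by positivity
    have : (k : ℝ) / P s * s ≤ speedOf D P k := by
      refine le_speedOf hP (mul_mem hP hs h0 h1) ((power_mul_le hP hs h0 h1).trans ?_)
      field_simp
      rfl
    rw [div_mul_eq_mul_div, div_le_iff₀ hPs'] at this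
    nlinarith [mul_nonneg (Nat.cast_nonneg (α := ℝ) k) hg.le]

end Power

/-! ### The late requests and their shares of the rate -/

section Late

variable {ι : Type*} [LinearOrder ι] {n : ℕ}

/-- The number of elements of `A` up to `i`. -/
def rank (A : Finset ι) (i : ι) : ℕ := (A.filter (· ≤ i)).card

/-- The last elements of `A`, about a fraction `β` of them. -/
def late (β : ℝ) (A : Finset ι) : Finset ι := A.filter fun i => (1 - β) * A.card < rank A i

theorem rank_le_card (A : Finset ι) (i : ι) : rank A i ≤ A.card :=
  Finset.card_le_card (Finset.filter_subset _ _)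

theorem one_le_rank {A : Finset ι} {i : ι} (hi : i ∈ A) : 1 ≤ rank A i :=
  Finset.card_pos.2 ⟨i, by simp [hi]⟩

theorem rank_lt_rank {A : Finset ι} {i j : ι} (hj : j ∈ A) (h : i < j) : rank A i < rank A j := by
  refine Finset.card_lt_card ?_
  rw [Finset.ssubset_iff_of_subset]
  · exact ⟨j, by simp [hj], by simp [h]⟩
  · intro x hx
    simp only [Finset.mem_filter] at hx ⊢
    exact ⟨hx.1, hx.2.trans h.le⟩

/-- Requests that are not late have distinct ranks between `1` and `⌊(1 - β) |A|⌋`. -/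
theorem le_card_late {β : ℝ} (hβ : β ≤ 1) (A : Finset ι) : β * A.card ≤ (late β A).card := by
  have h1 := Finset.card_filter_add_card_filter_not (s := A)
    (fun i => (1 - β) * A.card < rank A i)
  have h2 : (A.filter fun i => ¬ (1 - β) * A.card < rank A i).card ≤
      (Finset.Icc 1 ⌊(1 - β) * A.card⌋₊).card := by
    refine Finset.card_le_card_of_injOn (rank A) ?_ ?_
    · intro i hi
      simp only [Finset.coe_filter, mem_ofPred_eq, not_lt] at hi
      simp only [Finset.coe_Icc, mem_Icc]
      exact ⟨one_le_rank hi.1, Nat.le_floor hi.2⟩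
    · intro i hi j hj hij
      simp only [Finset.coe_filter, mem_ofPred_eq, not_lt] at hi hj
      rcases lt_trichotomy i j with h | h | h
      · exact absurd hij (rank_lt_rank hj.1 h).ne
      · exact h
      · exact absurd hij (rank_lt_rank hi.1 h).ne'
  rw [Nat.card_Icc, Nat.add_sub_cancel] at h2
  have h3 : (⌊(1 - β) * A.card⌋₊ : ℝ) ≤ (1 - β) * A.card :=
    Nat.floor_le (mul_nonneg (by linarith) (Nat.cast_nonneg _))
  have h4 : ((late β A).card : ℝ) + (A.filter fun i => ¬ (1 - β) * A.card < rank A i).card =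
      A.card := by
    exact_mod_cast h1
  have h5 : ((A.filter fun i => ¬ (1 - β) * A.card < rank A i).card : ℝ) ≤
      ⌊(1 - β) * A.card⌋₊ := by exact_mod_cast h2
  linarith

theorem late_nonempty {β : ℝ} (hβ : β ≤ 1) (h0 : 0 < β) {A : Finset ι} (hA : A.Nonempty) :
    (late β A).Nonempty := by
  have h1 := le_card_late hβ A
  have h2 : (0 : ℝ) < A.card := by exact_mod_cast hA.card_pos
  have h3 : (0 : ℝ) < (late β A).card := (mul_pos h0 h2).trans_le h1
  exact Finset.card_pos.1 (by exact_mod_cast h3)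

/-- The fraction of the late requests that are for page `p`. -/
def frac (β : ℝ) (pg : ι → Fin n) (A : Finset ι) (p : Fin n) : ℝ :=
  ((late β A).filter (pg · = p)).card / (late β A).card

theorem frac_nonneg (β : ℝ) (pg : ι → Fin n) (A : Finset ι) (p : Fin n) : 0 ≤ frac β pg A p := by
  unfold frac
  positivity

theorem sum_frac_le (β : ℝ) (pg : ι → Fin n) (A : Finset ι) : ∑ p, frac β pg A p ≤ 1 := by
  unfold frac
  rw [← Finset.sum_div]
  refine div_le_one_of_le₀ (le_of_eq ?_) (Nat.cast_nonneg _)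
  exact_mod_cast (Finset.card_eq_sum_card_fiberwise (f := pg) (s := late β A)
    (t := Finset.univ) (by simp)).symm

/-- The rate that is due to request `i`. -/
def share (β κ : ℝ) (γ : ℕ → ℝ) (A : Finset ι) (i : ι) : ℝ :=
  if i ∈ late β A then κ * γ A.card / (late β A).card else 0

theorem share_nonneg {β κ : ℝ} {γ : ℕ → ℝ} (hκ : 0 ≤ κ) (hγ : ∀ k, 0 ≤ γ k) (A : Finset ι)
    (i : ι) : 0 ≤ share β κ γ A i := by
  unfold share
  have := hγ A.card
  split_ifs <;> positivity

theorem sum_share (β κ : ℝ) (γ : ℕ → ℝ) (pg : ι → Fin n) (A : Finset ι) (p : Fin n) :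
    ∑ i ∈ A.filter (pg · = p), share β κ γ A i = κ * γ A.card * frac β pg A p := by
  unfold share frac
  rw [← Finset.sum_filter, Finset.sum_const, nsmul_eq_mul]
  have : (A.filter (pg · = p)).filter (· ∈ late β A) = (late β A).filter (pg · = p) := by
    ext i
    simp only [late, Finset.mem_filter]
    tauto
  rw [this]
  ring

theorem exists_frac_pos {β : ℝ} (hβ : β ≤ 1) (h0 : 0 < β) (pg : ι → Fin n) {A : Finset ι}
    (hA : A.Nonempty) : ∃ i ∈ A, 0 < frac β pg A (pg i) := by
  obtain ⟨i, hi⟩ := late_nonempty hβ h0 hA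
  refine ⟨i, (Finset.mem_filter.1 hi).1, ?_⟩
  refine div_pos ?_ ?_
  · exact_mod_cast Finset.card_pos.2 ⟨i, by simp [hi]⟩
  · exact_mod_cast Finset.card_pos.2 ⟨i, hi⟩

/-- The late requests that are not in `O` account for most of the processing. -/
theorem card_le_sum_share {β κ : ℝ} {γ : ℕ → ℝ} (hβ : β < 1) (h0 : 0 < β) (hκ : 0 ≤ κ)
    (hγ : ∀ k, 1 ≤ k → 0 < γ k) (hmono : Monotone γ) (A O : Finset ι) :
    κ * (1 - β) * A.card ≤ κ * (1 - β) / β * O.card +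
      ∑ i ∈ late β A \ O, share β κ γ A i * (rank A i / γ (rank A i)) := by
  rcases A.eq_empty_or_nonempty with rfl | hA
  · have : 0 ≤ κ * (1 - β) / β := div_nonneg (mul_nonneg hκ (by linarith)) h0.le
    simp only [Finset.card_empty, late]
    have := mul_nonneg this (Nat.cast_nonneg (α := ℝ) O.card)
    simpa using this
  have hA0 : (0 : ℝ) < A.card := by exact_mod_cast hA.card_pos
  have hL0 : (0 : ℝ) < (late β A).card := by exact_mod_cast (late_nonempty hβ.le h0 hA).card_pos
  have hL := le_card_late hβ.le A
  have hc : 0 ≤ κ * (1 - β) := mul_nonneg hκ (by linarith)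
  -- A late rank exceeds `(1 - β) |A|`, while `γ` at the rank is at most `γ |A|`, so the speed
  -- cancels from the weighted share.
  have h1 : ∀ i ∈ late β A \ O, κ * (1 - β) * A.card / (late β A).card ≤
      share β κ γ A i * (rank A i / γ (rank A i)) := by
    intro i hi
    have hi' := (Finset.mem_sdiff.1 hi).1
    have hiA := (Finset.mem_filter.1 hi').1
    have hr := (Finset.mem_filter.1 hi').2
    have hg := hγ _ (one_le_rank hiA)
    have hgA := hmono (rank_le_card A i)
    unfold share
    rw [if_pos hi', div_mul_div_comm, div_le_div_iff₀ hL0 (mul_pos hL0 hg)]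
    have : κ * (1 - β) * A.card * γ (rank A i) ≤ κ * γ A.card * rank A i := by
      calc κ * (1 - β) * A.card * γ (rank A i) = κ * (γ (rank A i) * ((1 - β) * A.card)) := by ring
        _ ≤ κ * (γ A.card * rank A i) := by
          have : 0 ≤ (1 - β) * A.card := mul_nonneg (by linarith) hA0.le
          gcongr
          exact hg.le.trans hgA
        _ = _ := by ring
    nlinarith
  have h2 := Finset.card_nsmul_le_sum _ _ _ h1
  rw [nsmul_eq_mul] at h2
  have h3 : ((late β A).card : ℝ) - O.card ≤ (late β A \ O).card := by
    have := Finset.le_card_sdiff O (late β A)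
    have h : (late β A).card ≤ (late β A \ O).card + O.card := by omega
    have : ((late β A).card : ℝ) ≤ (late β A \ O).card + O.card := by exact_mod_cast h
    linarith
  have h4 : 0 ≤ κ * (1 - β) * A.card / (late β A).card :=
    div_nonneg (mul_nonneg hc hA0.le) hL0.le
  have h5 := mul_le_mul_of_nonneg_right h3 h4
  have h6 : ((late β A).card - (O.card : ℝ)) * (κ * (1 - β) * A.card / (late β A).card) =
      κ * (1 - β) * A.card - κ * (1 - β) * (O.card * (A.card / (late β A).card)) := by
    field_simp
  have h7 : (A.card : ℝ) / (late β A).card ≤ 1 / β := by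
    rw [div_le_div_iff₀ hL0 h0]
    linarith
  have h8 : κ * (1 - β) * (O.card * (A.card / (late β A).card)) ≤
      κ * (1 - β) * (O.card * (1 / β)) := by gcongr
  have h9 : κ * (1 - β) * (O.card * (1 / β)) = κ * (1 - β) / β * O.card := by ring
  linarith

end Late

/-! ### The charging argument for the fractional flow -/

section Flow

variable {ι : Type*} {n : ℕ}

/-- Total flow time is the integral of the number of alive requests; this allows pointwise
comparison in time. -/
theorem lintegral_card_alive (a : ι → ℝ) (E : Finset ι) (b : ι → ℝ) :
    ∫⁻ t, ((alive a E b t).card : ℝ≥0∞) = ∑ i ∈ E, ENNReal.ofReal (b i - a i) := by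
  have : ∀ t, ((alive a E b t).card : ℝ≥0∞) =
      ∑ i ∈ E, (Ico (a i) (b i)).indicator (fun _ => (1 : ℝ≥0∞)) t := by
    intro t
    rw [alive, Finset.card_filter]
    push_cast
    refine Finset.sum_congr rfl fun i _ => ?_
    simp only [indicator, mem_Ico]
  simp_rw [this]
  rw [lintegral_finsetSum]
  · refine Finset.sum_congr rfl fun i _ => ?_
    rw [lintegral_indicator measurableSet_Ico]
    simp
  · exact fun i _ => measurable_const.indicator measurableSet_Ico

variable [LinearOrder ι]

theorem share_eq_zero {β κ : ℝ} {γ : ℕ → ℝ} {A : Finset ι} {i : ι} (hi : i ∉ A) :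
    share β κ γ A i = 0 := by
  unfold share
  rw [if_neg]
  exact fun h => hi (Finset.mem_filter.1 h).1

variable {a : ι → ℝ} {pg : ι → Fin n} {σ : Fin n → ℝ} {β κ : ℝ} {γ : ℕ → ℝ}
  {E : Finset ι} {b : ι → ℝ}

theorem measurable_share (i : ι) :
    Measurable fun t => ENNReal.ofReal (share β κ γ (alive a E b t) i) :=
  measurable_alive a E b fun A => ENNReal.ofReal (share β κ γ A i)

theorem lintegral_rate (hκ : 0 ≤ κ) (hγ : ∀ k, 0 ≤ γ k)
    (hb : IsCompletion a pg σ (fun A p => κ * γ A.card * frac β pg A p) E b) {i : ι} (hi : i ∈ E) :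
    ∫⁻ t in Ico (a i) (b i), ENNReal.ofReal
      (κ * γ (alive a E b t).card * frac β pg (alive a E b t) (pg i)) =
      ENNReal.ofReal (σ (pg i)) := by
  obtain ⟨h1, h2, -⟩ := hb i hi
  have hint := intervalIntegrable_alive a E b (fun A => κ * γ A.card * frac β pg A (pg i))
    (a i) (b i)
  rw [intervalIntegrable_iff_integrableOn_Ioc_of_le h1.le] at hint
  rw [← h2, intervalIntegral.integral_of_le h1.le, ofReal_integral_eq_lintegral_ofReal hint]
  · rw [restrict_Ico_eq_restrict_Ioc]
  · exact Filter.Eventually.of_forall fun t =>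
      mul_nonneg (mul_nonneg hκ (hγ _)) (frac_nonneg _ _ _ _)

/-- The processing of page `p` after time `u` that is due to requests alive at time `u` is at most
the size of the page. -/
theorem sum_lintegral_share_le (hκ : 0 ≤ κ) (hγ : ∀ k, 0 ≤ γ k)
    (hb : IsCompletion a pg σ (fun A p => κ * γ A.card * frac β pg A p) E b) (u : ℝ) (p : Fin n) :
    ∑ i ∈ (alive a E b u).filter (pg · = p),
      ∫⁻ t in Ici u, ENNReal.ofReal (share β κ γ (alive a E b t) i) ≤ ENNReal.ofReal (σ p) := by
  rcases ((alive a E b u).filter (pg · = p)).eq_empty_or_nonempty with h | h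
  · simp [h]
  -- Let `m` be the last of these requests to complete. After `b m` none of them has a share; before
  -- `b m` their shares sum to at most the rate of the page, whose integral from `a m` to `b m` is
  -- the page size.
  obtain ⟨m, hm, hmax⟩ := Finset.exists_max_image _ b h
  rw [Finset.mem_filter, mem_alive] at hm
  obtain ⟨⟨hmE, ham, hbm⟩, rfl⟩ := hm
  have h1 : ∀ i ∈ (alive a E b u).filter (pg · = pg m),
      ∫⁻ t in Ici u, ENNReal.ofReal (share β κ γ (alive a E b t) i) =
        ∫⁻ t in Ico u (b m), ENNReal.ofReal (share β κ γ (alive a E b t) i) := by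
    intro i hi
    rw [← lintegral_indicator measurableSet_Ici, ← lintegral_indicator measurableSet_Ico]
    refine lintegral_congr fun t => ?_
    simp only [indicator, mem_Ici, mem_Ico]
    by_cases ht : t < b m
    · simp [ht]
    · have : i ∉ alive a E b t := by
        rw [mem_alive]
        rintro ⟨-, -, h3⟩
        exact ht (h3.trans_le (hmax i hi))
      simp [share_eq_zero this]
  rw [Finset.sum_congr rfl h1, ← lintegral_finsetSum _ fun i _ => measurable_share i]
  rw [← lintegral_rate hκ hγ hb hmE]
  refine le_trans (lintegral_mono fun t => ?_) (lintegral_mono_set (Ico_subset_Ico_left ham))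
  rw [← sum_share, ENNReal.ofReal_sum_of_nonneg fun i _ => share_nonneg hκ hγ _ _]
  refine Finset.sum_le_sum_of_ne_zero fun i hi hne => ?_
  rw [Finset.mem_filter] at hi ⊢
  refine ⟨?_, hi.2⟩
  by_contra hc
  exact hne (by simp [share_eq_zero hc])

/-- The key inequality between the fractional schedule with completion times `b` and a schedule
that sends page `p` at rate `o p` and satisfies request `i` by time `f i`. -/
theorem flow_le (ha : Monotone a) (hσ : ∀ p, 0 < σ p) (hβ : β < 1) (h0 : 0 < β) (hκ : 0 ≤ κ)
    (hγ0 : ∀ k, 0 ≤ γ k) (hγ : ∀ k, 1 ≤ k → 0 < γ k) (hmono : Monotone γ)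
    (hdiv : ∀ j k : ℕ, 1 ≤ j → j ≤ k → (j : ℝ) / γ j ≤ k / γ k)
    (hb : IsCompletion a pg σ (fun A p => κ * γ A.card * frac β pg A p) E b)
    (f : ι → ℝ) (o : Fin n → ℝ → ℝ≥0∞) (ho : ∀ p, Measurable (o p))
    (hf : ∀ i ∈ E, ∀ t, f i ≤ t →
      ENNReal.ofReal (σ (pg i)) ≤ ∫⁻ u in Icc (a i) t, o (pg i) u) :
    ENNReal.ofReal (κ * (1 - β)) * ∑ i ∈ E, ENNReal.ofReal (b i - a i) ≤
      ENNReal.ofReal (κ * (1 - β) / β) * ∑ i ∈ E, ENNReal.ofReal (f i - a i) +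
        ∫⁻ u, (∑ p, o p u) *
          ENNReal.ofReal ((alive a E b u).card / γ (alive a E b u).card) := by
  set s : ι → ℝ → ℝ≥0∞ := fun i t => ENNReal.ofReal (share β κ γ (alive a E b t) i) with hs
  set h : ι → ℝ → ℝ≥0∞ := fun i t =>
    ENNReal.ofReal (rank (alive a E b t) i / γ (rank (alive a E b t) i)) with hh
  have hsm : ∀ i, Measurable (s i) := fun i => measurable_share i
  have hhm : ∀ i, Measurable (h i) := fun i =>
    measurable_alive a E b fun A => ENNReal.ofReal (rank A i / γ (rank A i))
  -- `W i t u` is the part of the weighted processing of `i` at time `t` that is charged to the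
  -- competitor's sending of the page at time `u`.
  set W : ι → ℝ → ℝ → ℝ≥0∞ := fun i t u => (ENNReal.ofReal (σ (pg i)))⁻¹ *
    {x : ℝ × ℝ | a i ≤ x.2 ∧ x.2 ≤ x.1}.indicator
      (fun x => s i x.1 * (h i x.2 * o (pg i) x.2)) (t, u) with hW
  have hWm : ∀ i, Measurable (Function.uncurry (W i)) := by
    intro i
    refine Measurable.const_mul (Measurable.indicator ?_ ?_) _
    · exact ((hsm i).comp measurable_fst).mul
        (((hhm i).comp measurable_snd).mul ((ho _).comp measurable_snd))
    · exact (measurableSet_le measurable_const measurable_snd).inter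
        (measurableSet_le measurable_snd measurable_fst)
  have hσ0 : ∀ p, ENNReal.ofReal (σ p) ≠ 0 := fun p => by simpa using hσ p
  have hσt : ∀ p, ENNReal.ofReal (σ p) ≠ ⊤ := fun p => ENNReal.ofReal_ne_top
  have hsh : ∀ (A : Finset ι) i, 0 ≤ share β κ γ A i := fun A i => share_nonneg hκ hγ0 A i
  -- the pointwise inequality
  have key : ∀ t, ENNReal.ofReal (κ * (1 - β)) * (alive a E b t).card ≤
      ENNReal.ofReal (κ * (1 - β) / β) * (alive a E f t).card + ∑ i ∈ E, ∫⁻ u, W i t u := by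
    intro t
    have h1 := card_le_sum_share hβ h0 hκ hγ hmono (alive a E b t) (alive a E f t)
    have h2 := ENNReal.ofReal_le_ofReal h1
    have hc : 0 ≤ κ * (1 - β) := mul_nonneg hκ (by linarith)
    rw [ENNReal.ofReal_mul hc, ENNReal.ofReal_natCast, ENNReal.ofReal_add
      (mul_nonneg (div_nonneg hc h0.le) (Nat.cast_nonneg _))
      (Finset.sum_nonneg fun i _ => mul_nonneg (hsh _ _)
        (div_nonneg (Nat.cast_nonneg _) (hγ0 _))),
      ENNReal.ofReal_mul (div_nonneg hc h0.le), ENNReal.ofReal_natCast,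
      ENNReal.ofReal_sum_of_nonneg fun i _ => mul_nonneg (hsh _ _)
        (div_nonneg (Nat.cast_nonneg _) (hγ0 _))] at h2
    refine h2.trans (add_le_add le_rfl ?_)
    have hsub : late β (alive a E b t) \ alive a E f t ⊆ E := fun i hi =>
      (mem_alive.1 (Finset.mem_filter.1 (Finset.mem_sdiff.1 hi).1).1).1
    refine le_trans (Finset.sum_le_sum fun i hi => ?_)
      (Finset.sum_le_sum_of_subset (f := fun i => ∫⁻ u, W i t u) hsub)
    obtain ⟨hi1, hi2⟩ := Finset.mem_sdiff.1 hi
    have hiA := (Finset.mem_filter.1 hi1).1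
    obtain ⟨hiE, hai, hbi⟩ := mem_alive.1 hiA
    -- Being outside the competitor's alive set means being satisfied, so a full page size was sent
    -- in `[a i, t]`; this makes the charges at least the amount to be paid.
    have hft : f i ≤ t := by
      by_contra hc
      exact hi2 (mem_alive.2 ⟨hiE, hai, not_le.1 hc⟩)
    have hY := hf i hiE t hft
    rw [ENNReal.ofReal_mul (hsh _ _)]
    calc s i t * h i t = s i t * h i t * ((ENNReal.ofReal (σ (pg i)))⁻¹ *
          ENNReal.ofReal (σ (pg i))) := by
          rw [ENNReal.inv_mul_cancel (hσ0 _) (hσt _), mul_one]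
      _ ≤ s i t * h i t * ((ENNReal.ofReal (σ (pg i)))⁻¹ *
          ∫⁻ u in Icc (a i) t, o (pg i) u) := by gcongr
      _ = ∫⁻ u in Icc (a i) t, (ENNReal.ofReal (σ (pg i)))⁻¹ * (s i t * (h i t * o (pg i) u)) := by
          rw [lintegral_const_mul _ (((ho _).const_mul _).const_mul _),
            lintegral_const_mul _ ((ho _).const_mul _), lintegral_const_mul _ (ho _)]
          ring
      _ ≤ ∫⁻ u, W i t u := by
          rw [← lintegral_indicator measurableSet_Icc]
          refine lintegral_mono fun u => ?_
          simp only [hW, indicator, mem_Icc, mem_ofPred_eq]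
          split_ifs with hu
          -- Requests up to `i` that are alive at `t` arrived by `a i ≤ u`, hence were alive at `u`:
          -- the rank of `i` only falls with time. This is why the order must follow arrival times.
          · have : h i t ≤ h i u := by
              refine ENNReal.ofReal_le_ofReal (hdiv _ _ (one_le_rank hiA) ?_)
              refine Finset.card_le_card fun j hj => ?_
              rw [Finset.mem_filter, mem_alive] at hj ⊢
              exact ⟨⟨hj.1.1, (ha hj.2).trans hu.1, hu.2.trans_lt hj.1.2.2⟩, hj.2⟩
            gcongr
          · exact zero_le
  -- the sections of `W`
  have hsec : ∀ u, ∑ i ∈ E, ∫⁻ t, W i t u ≤ (∑ p, o p u) *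
      ENNReal.ofReal ((alive a E b u).card / γ (alive a E b u).card) := by
    intro u
    set H := ENNReal.ofReal ((alive a E b u).card / γ (alive a E b u).card) with hH
    have h1 : ∀ i ∈ E, ∫⁻ t, W i t u ≤ if i ∈ alive a E b u then
        o (pg i) u * H * ((ENNReal.ofReal (σ (pg i)))⁻¹ * ∫⁻ t in Ici u, s i t) else 0 := by
      intro i hi
      have h2 : ∫⁻ t, W i t u ≤
          (ENNReal.ofReal (σ (pg i)))⁻¹ * ((∫⁻ t in Ici u, s i t) * (h i u * o (pg i) u)) := by
        rw [← lintegral_mul_const _ (hsm i), ← lintegral_const_mul _ ((hsm i).mul_const _),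
          ← lintegral_indicator measurableSet_Ici]
        refine lintegral_mono fun t => ?_
        simp only [hW, indicator, mem_Ici, mem_ofPred_eq]
        by_cases h3 : a i ≤ u <;> by_cases h4 : u ≤ t <;> simp [h3, h4]
      split_ifs with hiu
      · refine h2.trans ?_
        have : h i u ≤ H := ENNReal.ofReal_le_ofReal (hdiv _ _ (one_le_rank hiu) (rank_le_card _ _))
        calc _ ≤ (ENNReal.ofReal (σ (pg i)))⁻¹ * ((∫⁻ t in Ici u, s i t) * (H * o (pg i) u)) := by
              gcongr
          _ = _ := by ring
      · by_cases hau : a i ≤ u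
        · refine h2.trans (le_of_eq ?_)
          have : ∫⁻ t in Ici u, s i t = 0 := by
            rw [← lintegral_indicator measurableSet_Ici, ← lintegral_zero (μ := (volume : Measure ℝ))]
            refine lintegral_congr fun t => ?_
            simp only [indicator, mem_Ici]
            split_ifs with hut
            · have : i ∉ alive a E b t := fun hc => by
                obtain ⟨-, -, h5⟩ := mem_alive.1 hc
                exact hiu (mem_alive.2 ⟨hi, hau, hut.trans_lt h5⟩)
              simp [hs, share_eq_zero this]
            · rfl
          simp [this]
        · refine le_of_eq ?_
          rw [← lintegral_zero (μ := (volume : Measure ℝ))]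
          refine lintegral_congr fun t => ?_
          simp [hW, indicator, hau]
    refine (Finset.sum_le_sum h1).trans ?_
    rw [← Finset.sum_filter]
    have h6 : E.filter (· ∈ alive a E b u) = alive a E b u := by
      ext i
      simp only [Finset.mem_filter, mem_alive]
      tauto
    rw [h6, ← Finset.sum_fiberwise _ pg, Finset.sum_mul]
    refine Finset.sum_le_sum fun p _ => ?_
    have h7 : ∀ i ∈ (alive a E b u).filter (pg · = p),
        o (pg i) u * H * ((ENNReal.ofReal (σ (pg i)))⁻¹ * ∫⁻ t in Ici u, s i t) =
        o p u * H * (ENNReal.ofReal (σ p))⁻¹ * ∫⁻ t in Ici u, s i t := by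
      intro i hi
      rw [(Finset.mem_filter.1 hi).2]
      ring
    rw [Finset.sum_congr rfl h7, ← Finset.mul_sum]
    calc _ ≤ o p u * H * (ENNReal.ofReal (σ p))⁻¹ * ENNReal.ofReal (σ p) := by
          gcongr
          exact sum_lintegral_share_le hκ hγ0 hb u p
      _ = o p u * H := by
          rw [mul_assoc, ENNReal.inv_mul_cancel (hσ0 _) (hσt _), mul_one]
  have hmf : ∀ c : ι → ℝ, Measurable fun t => ((alive a E c t).card : ℝ≥0∞) := fun c =>
    measurable_alive a E c fun A => (A.card : ℝ≥0∞)
  calc _ = ∫⁻ t, ENNReal.ofReal (κ * (1 - β)) * (alive a E b t).card := by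
        rw [lintegral_const_mul _ (hmf b), lintegral_card_alive]
    _ ≤ ∫⁻ t, (ENNReal.ofReal (κ * (1 - β) / β) * (alive a E f t).card +
          ∑ i ∈ E, ∫⁻ u, W i t u) := lintegral_mono key
    _ = ENNReal.ofReal (κ * (1 - β) / β) * ∑ i ∈ E, ENNReal.ofReal (f i - a i) +
          ∑ i ∈ E, ∫⁻ t, ∫⁻ u, W i t u := by
        rw [lintegral_add_left ((hmf f).const_mul _), lintegral_const_mul _ (hmf f),
          lintegral_card_alive, lintegral_finsetSum]
        exact fun i _ => (hWm i).lintegral_prod_right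
    _ = ENNReal.ofReal (κ * (1 - β) / β) * ∑ i ∈ E, ENNReal.ofReal (f i - a i) +
          ∫⁻ u, ∑ i ∈ E, ∫⁻ t, W i t u := by
        rw [lintegral_finsetSum _ fun i _ => (hWm i).lintegral_prod_left]
        congr 1
        exact Finset.sum_congr rfl fun i _ => lintegral_lintegral_swap (hWm i).aemeasurable
    _ ≤ _ := add_le_add le_rfl (lintegral_mono hsec)

end Flow

/-! ### The clock of a page and its generalized inverse -/

section Clock

/-- The amount of time up to `t` spent at the time share `φ`. -/
def clock (φ : ℝ → ℝ≥0) (t : ℝ) : ℝ := ∫ x in (0 : ℝ)..t, (φ x : ℝ)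

/-- The first time at which `clock φ` is at least `θ`. -/
def unclock (φ : ℝ → ℝ≥0) (θ : ℝ) : ℝ := sInf {x | 0 ≤ x ∧ θ ≤ clock φ x}

variable {φ : ℝ → ℝ≥0}

theorem intervalIntegrable_share (hφ : Measurable φ) (h1 : ∀ t, φ t ≤ 1) (x y : ℝ) :
    IntervalIntegrable (fun t => (φ t : ℝ)) volume x y := by
  refine (intervalIntegrable_const (c := (1 : ℝ))).mono_fun
    (measurable_coe_nnreal_real.comp hφ).aestronglyMeasurable
    (Filter.Eventually.of_forall fun t => ?_)
  simpa using h1 t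

theorem clock_zero : clock φ 0 = 0 := intervalIntegral.integral_same

theorem clock_sub (hφ : Measurable φ) (h1 : ∀ t, φ t ≤ 1) (x y : ℝ) :
    clock φ y - clock φ x = ∫ t in x..y, (φ t : ℝ) :=
  intervalIntegral.integral_interval_sub_left (intervalIntegrable_share hφ h1 _ _)
    (intervalIntegrable_share hφ h1 _ _)

theorem clock_mono (hφ : Measurable φ) (h1 : ∀ t, φ t ≤ 1) : Monotone (clock φ) := by
  intro x y hxy
  rw [← sub_nonneg, clock_sub hφ h1]
  exact intervalIntegral.integral_nonneg hxy fun t _ => (φ t).2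

theorem continuous_clock (hφ : Measurable φ) (h1 : ∀ t, φ t ≤ 1) : Continuous (clock φ) :=
  intervalIntegral.continuous_primitive (fun x y => intervalIntegrable_share hφ h1 x y) 0

theorem ofReal_clock_sub (hφ : Measurable φ) (h1 : ∀ t, φ t ≤ 1) {x y : ℝ} (hxy : x ≤ y) :
    ENNReal.ofReal (clock φ y - clock φ x) = ∫⁻ t in Ioc x y, (φ t : ℝ≥0∞) := by
  have hint := intervalIntegrable_share hφ h1 x y
  rw [intervalIntegrable_iff_integrableOn_Ioc_of_le hxy] at hint
  rw [clock_sub hφ h1, intervalIntegral.integral_of_le hxy, ofReal_integral_eq_lintegral_ofReal hint]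
  · simp
  · exact Filter.Eventually.of_forall fun t => (φ t).2

theorem sum_clock_sub_le {n : ℕ} {φ : Fin n → ℝ → ℝ≥0} (hφ : ∀ p, Measurable (φ p)) {lam : ℝ≥0}
    (hlam : lam ≤ 1) (hsum : ∀ t, ∑ p, φ p t ≤ lam) {x y : ℝ} (hxy : x ≤ y) :
    ∑ p, (clock (φ p) y - clock (φ p) x) ≤ lam * (y - x) := by
  have h1 : ∀ p t, φ p t ≤ 1 := fun p t =>
    (Finset.single_le_sum (f := fun p => φ p t) (fun _ _ => zero_le)
      (Finset.mem_univ p)).trans ((hsum t).trans hlam)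
  simp_rw [fun p => clock_sub (hφ p) (h1 p) x y]
  rw [← intervalIntegral.integral_finsetSum fun p _ => intervalIntegrable_share (hφ p) (h1 p) x y]
  have : ∫ t in x..y, ∑ p, (φ p t : ℝ) ≤ ∫ _ in x..y, (lam : ℝ) := by
    refine intervalIntegral.integral_mono_on hxy ?_ (by simp) fun t _ => ?_
    · have := IntervalIntegrable.sum (Finset.univ : Finset (Fin n)) (μ := volume) (a := x) (b := y)
        (f := fun p t => (φ p t : ℝ)) fun p _ => intervalIntegrable_share (hφ p) (h1 p) x y
      have e : (∑ p, fun t => (φ p t : ℝ)) = fun t => ∑ p, (φ p t : ℝ) := by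
        ext t
        simp
      rwa [e] at this
    · exact_mod_cast hsum t
  refine this.trans (le_of_eq ?_)
  rw [intervalIntegral.integral_const, smul_eq_mul, mul_comm]

theorem bddBelow_unclock (θ : ℝ) : BddBelow {x | 0 ≤ x ∧ θ ≤ clock φ x} := ⟨0, fun _ h => h.1⟩

theorem unclock_nonneg (θ : ℝ) : 0 ≤ unclock φ θ := Real.sInf_nonneg fun _ h => h.1

theorem unclock_le (θ : ℝ) {c : ℝ} (hc : 0 ≤ c) (h : θ ≤ clock φ c) : unclock φ θ ≤ c :=
  csInf_le (bddBelow_unclock θ) ⟨hc, h⟩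

/-- The Galois connection between a continuous monotone function and its generalized inverse. The
witness `T` excludes points that the clock never reaches, where the infimum over `∅` is `0`. -/
theorem unclock_le_iff (hφ : Measurable φ) (h1 : ∀ t, φ t ≤ 1) {θ c T : ℝ} (hT : 0 ≤ T)
    (hθ : θ ≤ clock φ T) (hc : 0 ≤ c) : unclock φ θ ≤ c ↔ θ ≤ clock φ c := by
  refine ⟨fun h => ?_, unclock_le θ hc⟩
  have hcl : IsClosed {x | 0 ≤ x ∧ θ ≤ clock φ x} :=
    isClosed_Ici.inter (isClosed_le continuous_const (continuous_clock hφ h1))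
  have := hcl.csInf_mem ⟨T, hT, hθ⟩ (bddBelow_unclock θ)
  exact this.2.trans (clock_mono hφ h1 h)

theorem measurable_unclock (hφ : Measurable φ) (h1 : ∀ t, φ t ≤ 1) : Measurable (unclock φ) := by
  refine measurable_of_Iic fun c => ?_
  by_cases hc : 0 ≤ c
  -- The second set consists of the points that the clock never reaches; `unclock` takes the default
  -- value `0` there.
  · have : unclock φ ⁻¹' Iic c = Iic (clock φ c) ∪ {θ | ∀ x, 0 ≤ x → clock φ x < θ} := by
      ext θ
      simp only [mem_preimage, mem_Iic, mem_union, mem_ofPred_eq]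
      by_cases h : ∀ x, 0 ≤ x → clock φ x < θ
      · have h0 : {x | 0 ≤ x ∧ θ ≤ clock φ x} = ∅ := by
          ext x
          simp only [mem_ofPred_eq, mem_empty_iff_false, iff_false, not_and, not_le]
          exact h x
        refine iff_of_true ?_ (Or.inr h)
        simp only [unclock, h0, Real.sInf_empty]
        exact hc
      · push Not at h
        obtain ⟨T, hT, hθ⟩ := h
        rw [unclock_le_iff hφ h1 hT hθ hc]
        constructor
        · exact Or.inl
        · rintro (h | h)
          · exact h
          · exact absurd (h T hT) (not_lt.2 hθ)
    rw [this]
    refine measurableSet_Iic.union ?_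
    have hU : IsUpperSet {θ : ℝ | ∀ x, 0 ≤ x → clock φ x < θ} :=
      fun s t hst hs x hx => (hs x hx).trans_le hst
    exact hU.ordConnected.measurableSet
  · convert MeasurableSet.empty
    ext θ
    simp only [mem_preimage, mem_Iic, mem_empty_iff_false, iff_false, not_le]
    exact (not_le.1 hc).trans_le (unclock_nonneg θ)

/-- Both finite measures give `Iic c` the increase of the clock over `(x, min c y]`. Intervals on
which the clock stands still are invisible to both. -/
theorem map_unclock (hφ : Measurable φ) (h1 : ∀ t, φ t ≤ 1) {x y : ℝ} (hx : 0 ≤ x) (hxy : x ≤ y) :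
    (volume.restrict (Ioc (clock φ x) (clock φ y))).map (unclock φ) =
      (volume.restrict (Ioc x y)).withDensity fun t => (φ t : ℝ≥0∞) := by
  have hm := clock_mono hφ h1
  have hfin : IsFiniteMeasure ((volume.restrict (Ioc (clock φ x) (clock φ y))).map (unclock φ)) :=
    inferInstance
  refine Measure.ext_of_Iic _ _ fun c => ?_
  rw [Measure.map_apply (measurable_unclock hφ h1) measurableSet_Iic,
    Measure.restrict_apply ((measurable_unclock hφ h1) measurableSet_Iic),
    withDensity_apply _ measurableSet_Iic, Measure.restrict_restrict measurableSet_Iic]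
  have e2 : Iic c ∩ Ioc x y = Ioc x (min c y) := by
    ext t
    simp only [mem_inter_iff, mem_Iic, mem_Ioc, le_min_iff]
    tauto
  rw [e2]
  rcases lt_or_ge c x with hcx | hcx
  · have e1 : unclock φ ⁻¹' Iic c ∩ Ioc (clock φ x) (clock φ y) = ∅ := by
      ext θ
      simp only [mem_inter_iff, mem_preimage, mem_Iic, mem_Ioc, mem_empty_iff_false, iff_false]
      rintro ⟨h2, h3, h4⟩
      have h5 : 0 ≤ c := (unclock_nonneg θ).trans h2
      rw [unclock_le_iff hφ h1 (hx.trans hxy) h4 h5] at h2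
      exact absurd (h2.trans (hm hcx.le)) (not_le.2 h3)
    rw [e1, Ioc_eq_empty (not_lt.2 ((min_le_left c y).trans hcx.le))]
    simp
  · have h0 : 0 ≤ c := hx.trans hcx
    have e1 : unclock φ ⁻¹' Iic c ∩ Ioc (clock φ x) (clock φ y) =
        Ioc (clock φ x) (clock φ (min c y)) := by
      ext θ
      simp only [mem_inter_iff, mem_preimage, mem_Iic, mem_Ioc, hm.map_min, le_min_iff]
      constructor
      · rintro ⟨h2, h3, h4⟩
        rw [unclock_le_iff hφ h1 (hx.trans hxy) h4 h0] at h2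
        exact ⟨h3, h2, h4⟩
      · rintro ⟨h3, h2, h4⟩
        rw [unclock_le_iff hφ h1 (hx.trans hxy) h4 h0]
        exact ⟨h2, h3, h4⟩
    rw [e1, Real.volume_Ioc, ofReal_clock_sub hφ h1 (le_min hcx hxy)]

/-- Change of variables from the clock of a page to real time. -/
theorem lintegral_comp_unclock (hφ : Measurable φ) (h1 : ∀ t, φ t ≤ 1) {x y : ℝ} (hx : 0 ≤ x)
    (hxy : x ≤ y) {f : ℝ → ℝ≥0∞} (hf : Measurable f) :
    ∫⁻ θ in Ico (clock φ x) (clock φ y), f (unclock φ θ) = ∫⁻ t in Ico x y, φ t * f t := by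
  rw [restrict_Ico_eq_restrict_Ioc, restrict_Ico_eq_restrict_Ioc,
    ← lintegral_map hf (measurable_unclock hφ h1), map_unclock hφ h1 hx hxy,
    lintegral_withDensity_eq_lintegral_mul _ hφ.coe_nnreal_ennreal hf]
  rfl

theorem lintegral_Ico_translate (f : ℝ → ℝ≥0∞) (θ s u : ℝ) :
    ∫⁻ x in Ico s u, f (θ + (x - s)) = ∫⁻ x in Ico θ (θ + (u - s)), f x := by
  rw [← lintegral_indicator measurableSet_Ico, ← lintegral_indicator measurableSet_Ico,
    
    ← lintegral_add_right_eq_self ((Ico θ (θ + (u - s))).indicator f) (θ - s)]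
  refine lintegral_congr fun x => ?_
  simp only [indicator, mem_Ico]
  have e : x + (θ - s) = θ + (x - s) := by ring
  rw [e]
  have : (θ ≤ θ + (x - s) ∧ θ + (x - s) < θ + (u - s)) ↔ (s ≤ x ∧ x < u) := by
    constructor <;> rintro ⟨h1, h2⟩ <;> constructor <;> linarith
  simp only [this]

end Clock

/-! ### Fractional traces and the event-driven replay -/

/-- A fractional schedule of the requests in `E`: request `i` is completed at time `b i`, and at
time `t` the share `φ p t` of the time is used to send page `p` at rate `v t`. -/
structure Trace (ι : Type*) (n : ℕ) where
  E : Finset ι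
  b : ι → ℝ
  φ : Fin n → ℝ → ℝ≥0
  v : ℝ → ℝ≥0

/-- The slack `1 - lam` is the fraction of time that the fractional schedule leaves free, with which
the replay catches up. -/
structure Trace.Valid {ι : Type*} {n : ℕ} (D : Trace ι n) (a : ι → ℝ) (pg : ι → Fin n)
    (σ : Fin n → ℝ≥0) (lam : ℝ≥0) : Prop where
  nonneg : ∀ i, 0 ≤ a i
  lt : ∀ i ∈ D.E, a i < D.b i
  measurable_share : ∀ p, Measurable (D.φ p)
  measurable_rate : Measurable D.v
  lam_lt : lam < 1
  sum_le : ∀ t, ∑ p, D.φ p t ≤ lam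
  size_pos : ∀ p, 0 < σ p
  work : ∀ i ∈ D.E, ∫⁻ t in Ico (a i) (D.b i), (D.φ (pg i) t : ℝ≥0∞) * D.v t = σ (pg i)

/-- The state of the integral schedule, which replays a fractional schedule page by page.  The
replay of page `p` has reached the point `coord p` on the clock of that page, and the current
broadcast is a replay of the window from `fst p` to `lst p`.  The requests for page `p` that arrived
by time `served p` are satisfied. -/
structure ReplayState (n : ℕ) where
  time : ℝ
  coord : Fin n → ℝ
  fst : Fin n → ℝ
  lst : Fin n → ℝ
  served : Fin n → ℝ

open Classical in
/-- An element of `Q` at which `w` is least. -/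
def pickMin {ι : Type*} (Q : Finset ι) (w : ι → ℝ) : Option ι :=
  if h : Q.Nonempty then some (Finset.exists_min_image Q w h).choose else none

theorem pickMin_eq_none {ι : Type*} {Q : Finset ι} {w : ι → ℝ} (h : pickMin Q w = none) :
    Q = ∅ := by
  unfold pickMin at h
  split_ifs at h with hQ
  exact Finset.not_nonempty_iff_eq_empty.1 hQ

theorem pickMin_eq_some {ι : Type*} {Q : Finset ι} {w : ι → ℝ} {r : ι}
    (h : pickMin Q w = some r) : r ∈ Q ∧ ∀ i ∈ Q, w r ≤ w i := by
  unfold pickMin at h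
  split_ifs at h with hQ
  have := (Finset.exists_min_image Q w hQ).choose_spec
  rw [Option.some.inj h] at this
  exact this

section Replay

variable {ι : Type*} {n : ℕ} (a : ι → ℝ) (pg : ι → Fin n) (D : Trace ι n)

/-- The position of time `t` on the clock of page `p`. -/
def Trace.pos (p : Fin n) (t : ℝ) : ℝ := clock (D.φ p) t

open Classical in
/-- The requests that are completed in the fractional schedule but not yet satisfied. -/
def queue (s : ReplayState n) : Finset ι :=
  D.E.filter fun i => D.b i ≤ s.time ∧ s.served (pg i) < a i

open Classical in
/-- The request in the queue whose fractional flow time is least. -/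
def pick (s : ReplayState n) : Option ι :=
  -- `pickMin` breaks ties by choice and so depends on the whole weight function; the value `0` off
  -- the queue hides completion times that are still in the future.
  pickMin (queue a pg D s) fun i => if i ∈ queue a pg D s then D.b i - a i else 0

open Classical in
/-- Start to work for request `r`, by a new broadcast if necessary. -/
def start (s : ReplayState n) (r : ι) : ReplayState n :=
  -- A broadcast under way that is already past the arrival of `r` on the clock ends at some `lst ≥
  -- a r` and will serve `r` too; otherwise the replay jumps forward to the window of `r`.
  if D.pos (pg r) (a r) ≤ s.coord (pg r) ∧ s.coord (pg r) < D.pos (pg r) (s.lst (pg r)) then s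
  else { s with
    coord := Function.update s.coord (pg r) (D.pos (pg r) (a r))
    fst := Function.update s.fst (pg r) (a r)
    lst := Function.update s.lst (pg r) (D.b r) }

open Classical in
/-- The next fractional completion after time `t`, if it is before time `t + 1`. -/
def nextTime (t : ℝ) : ℝ :=
  -- The bound `t + 1` keeps time moving once there are no further completions.
  (insert (t + 1) ((D.E.filter (t < D.b ·)).image D.b)).min' (Finset.insert_nonempty _ _)

open Classical in
/-- Work for page `p` until the next event. -/
def advance (s : ReplayState n) (p : Fin n) : ReplayState n :=
  if s.time + (D.pos p (s.lst p) - s.coord p) ≤ nextTime D s.time then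
    { s with
      time := s.time + (D.pos p (s.lst p) - s.coord p)
      coord := Function.update s.coord p (D.pos p (s.lst p))
      served := Function.update s.served p (s.lst p) }
  else
    { s with
      time := nextTime D s.time
      coord := Function.update s.coord p (s.coord p + (nextTime D s.time - s.time)) }

def step (s : ReplayState n) : ReplayState n :=
  match pick a pg D s with
  | none => { s with time := nextTime D s.time }
  | some r => advance D (start a pg D s r) (pg r)

/-- The state after `j` events. -/
def run : ℕ → ReplayState n
  -- `served` starts at `-1` so that requests arriving at time `0` count as unserved.
  | 0 => ⟨0, fun _ => 0, fun _ => 0, fun _ => 0, fun _ => -1⟩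
  | j + 1 => step a pg D (run j)

variable {a pg D}

theorem lt_nextTime (t : ℝ) : t < nextTime D t := by
  classical
  unfold nextTime
  rw [Finset.lt_min'_iff]
  intro y hy
  rw [Finset.mem_insert, Finset.mem_image] at hy
  rcases hy with rfl | ⟨i, hi, rfl⟩
  · linarith
  · exact (Finset.mem_filter.1 hi).2

theorem nextTime_le {t : ℝ} {i : ι} (hi : i ∈ D.E) (h : t < D.b i) : nextTime D t ≤ D.b i := by
  classical
  refine Finset.min'_le _ _ (Finset.mem_insert_of_mem (Finset.mem_image_of_mem _ ?_))
  simp [hi, h]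

theorem nextTime_eq (t : ℝ) : nextTime D t = t + 1 ∨ ∃ i ∈ D.E, t < D.b i ∧ nextTime D t = D.b i := by
  classical
  have := Finset.min'_mem (insert (t + 1) ((D.E.filter (t < D.b ·)).image D.b))
    (Finset.insert_nonempty _ _)
  rw [Finset.mem_insert, Finset.mem_image] at this
  rcases this with h | ⟨i, hi, h⟩
  · exact Or.inl h
  · rw [Finset.mem_filter] at hi
    exact Or.inr ⟨i, hi.1, hi.2, h.symm⟩

theorem mem_queue {s : ReplayState n} {i : ι} :
    i ∈ queue a pg D s ↔ i ∈ D.E ∧ D.b i ≤ s.time ∧ s.served (pg i) < a i := by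
  simp [queue]

theorem pick_eq_some {s : ReplayState n} {r : ι} (h : pick a pg D s = some r) :
    (r ∈ D.E ∧ D.b r ≤ s.time ∧ s.served (pg r) < a r) ∧
      ∀ i ∈ queue a pg D s, D.b r - a r ≤ D.b i - a i := by
  obtain ⟨h1, h2⟩ := pickMin_eq_some h
  refine ⟨mem_queue.1 h1, fun i hi => ?_⟩
  have := h2 i hi
  simpa [h1, hi] using this

theorem Trace.pos_zero (p : Fin n) : D.pos p 0 = 0 := clock_zero

namespace Trace.Valid

variable {σ : Fin n → ℝ≥0} {lam : ℝ≥0} (hD : D.Valid a pg σ lam)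
include hD

theorem share_le_one (p : Fin n) (t : ℝ) : D.φ p t ≤ 1 :=
  (Finset.single_le_sum (f := fun p => D.φ p t) (fun _ _ => zero_le)
    (Finset.mem_univ p)).trans ((hD.sum_le t).trans hD.lam_lt.le)

theorem pos_mono (p : Fin n) : Monotone (D.pos p) :=
  clock_mono (hD.measurable_share p) (hD.share_le_one p)

theorem b_pos {i : ι} (hi : i ∈ D.E) : 0 < D.b i := (hD.nonneg i).trans_lt (hD.lt i hi)

/-- The rate at which the point `θ` on the clock of page `p` is replayed. -/
theorem measurable_replay (p : Fin n) : Measurable fun θ => D.v (unclock (D.φ p) θ) :=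
  hD.measurable_rate.comp (measurable_unclock (hD.measurable_share p) (hD.share_le_one p))

theorem lintegral_replay {i : ι} (hi : i ∈ D.E) :
    ∫⁻ θ in Ico (D.pos (pg i) (a i)) (D.pos (pg i) (D.b i)),
      (D.v (unclock (D.φ (pg i)) θ) : ℝ≥0∞) = σ (pg i) := by
  rw [← hD.work i hi]
  exact lintegral_comp_unclock (hD.measurable_share _) (hD.share_le_one _) (hD.nonneg i)
    (hD.lt i hi).le (hD.measurable_rate.coe_nnreal_ennreal)

theorem pos_lt {i : ι} (hi : i ∈ D.E) : D.pos (pg i) (a i) < D.pos (pg i) (D.b i) := by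
  by_contra hc
  have := hD.lintegral_replay hi
  rw [Ico_eq_empty hc] at this
  simp only [Measure.restrict_empty, lintegral_zero_measure] at this
  have h := hD.size_pos (pg i)
  exact absurd this.symm (by exact_mod_cast h.ne')

end Trace.Valid

-- `coord_le` says that the replay never overtakes the fractional schedule, `window` that an
-- unfinished broadcast replays the window of one request. `idle` ensures that after a finished
-- broadcast every unserved request starts at or ahead of the current coordinate, so that
-- coordinates never decrease.
variable (a pg D) in
structure Inv (s : ReplayState n) : Prop where
  time_nonneg : 0 ≤ s.time
  coord_nonneg : ∀ p, 0 ≤ s.coord p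
  coord_le : ∀ p, s.coord p ≤ D.pos p s.time
  lst_le : ∀ p, s.lst p ≤ s.time
  window : ∀ p, s.coord p < D.pos p (s.lst p) → ∃ i ∈ D.E, pg i = p ∧ s.fst p = a i ∧
    s.lst p = D.b i ∧ s.served p < s.lst p ∧ D.pos p (s.fst p) ≤ s.coord p
  idle : ∀ i ∈ D.E, s.served (pg i) < a i → D.pos (pg i) (s.lst (pg i)) ≤ s.coord (pg i) →
    s.coord (pg i) ≤ D.pos (pg i) (a i)

variable {σ : Fin n → ℝ≥0} {lam : ℝ≥0}

/-- The properties of the state in which the work for request `r` starts. -/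
theorem start_spec (hD : D.Valid a pg σ lam) {s : ReplayState n} (hs : Inv a pg D s) {r : ι}
    (hr : pick a pg D s = some r) :
    Inv a pg D (start a pg D s r) ∧ (start a pg D s r).time = s.time ∧
      (start a pg D s r).served = s.served ∧ (∀ p, s.coord p ≤ (start a pg D s r).coord p) ∧
      (∀ p, p ≠ pg r → (start a pg D s r).coord p = s.coord p ∧
        (start a pg D s r).fst p = s.fst p ∧ (start a pg D s r).lst p = s.lst p) ∧
      D.pos (pg r) (a r) ≤ (start a pg D s r).coord (pg r) ∧
      (start a pg D s r).coord (pg r) < D.pos (pg r) ((start a pg D s r).lst (pg r)) ∧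
      ((start a pg D s r).coord (pg r) = s.coord (pg r) ∧
        (start a pg D s r).fst (pg r) = s.fst (pg r) ∧
        (start a pg D s r).lst (pg r) = s.lst (pg r) ∧
        s.coord (pg r) < D.pos (pg r) (s.lst (pg r)) ∨
        (start a pg D s r).coord (pg r) = D.pos (pg r) (a r) ∧
        (start a pg D s r).fst (pg r) = a r ∧ (start a pg D s r).lst (pg r) = D.b r) := by
  classical
  obtain ⟨⟨hrE, hrb, hra⟩, -⟩ := pick_eq_some hr
  by_cases hc : D.pos (pg r) (a r) ≤ s.coord (pg r) ∧ s.coord (pg r) < D.pos (pg r) (s.lst (pg r))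
  · have e : start a pg D s r = s := by
      unfold start
      rw [if_pos hc]
    rw [e]
    exact ⟨hs, rfl, rfl, fun _ => le_rfl, fun _ _ => ⟨rfl, rfl, rfl⟩, hc.1, hc.2,
      Or.inl ⟨rfl, rfl, rfl, hc.2⟩⟩
  · have e : start a pg D s r = { s with
        coord := Function.update s.coord (pg r) (D.pos (pg r) (a r))
        fst := Function.update s.fst (pg r) (a r)
        lst := Function.update s.lst (pg r) (D.b r) } := by
      unfold start
      rw [if_neg hc]
    -- If the coordinate were beyond the arrival of `r`, the broadcast not being reusable would mean
    -- that it is finished, contradicting `idle`.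
    have hle : s.coord (pg r) ≤ D.pos (pg r) (a r) := by
      by_contra h
      exact h (hs.idle r hrE hra (not_lt.1 fun h2 => hc ⟨(not_le.1 h).le, h2⟩))
    rw [e]
    refine ⟨⟨hs.time_nonneg, fun p => ?_, fun p => ?_, fun p => ?_, fun p => ?_, fun i hi => ?_⟩, rfl, rfl,
      fun p => ?_, fun p hp => ?_, ?_, ?_, ?_⟩
    · by_cases hp : p = pg r
      · subst hp
        simp only [Function.update_self]
        exact (hs.coord_nonneg _).trans hle
      · simp only [Function.update_of_ne hp]
        exact hs.coord_nonneg p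
    · by_cases hp : p = pg r
      · subst hp
        simp only [Function.update_self]
        exact hD.pos_mono _ ((hD.lt r hrE).le.trans hrb)
      · simp only [Function.update_of_ne hp]
        exact hs.coord_le p
    · by_cases hp : p = pg r
      · subst hp
        simp only [Function.update_self]
        exact hrb
      · simp only [Function.update_of_ne hp]
        exact hs.lst_le p
    · by_cases hp : p = pg r
      · subst hp
        simp only [Function.update_self]
        intro _
        exact ⟨r, hrE, rfl, rfl, rfl, hra.trans (hD.lt r hrE), le_rfl⟩
      · simp only [Function.update_of_ne hp]
        exact hs.window p
    · by_cases hp : pg i = pg r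
      · simp only [hp, Function.update_self]
        intro _ h
        exact absurd h (not_le.2 (hD.pos_lt hrE))
      · simp only [Function.update_of_ne hp]
        exact hs.idle i hi
    · by_cases hp : p = pg r
      · subst hp
        simp only [Function.update_self]
        exact hle
      · simp only [Function.update_of_ne hp]
        exact le_rfl
    · simp only [Function.update_of_ne hp, and_self]
    · simp only [Function.update_self, le_refl]
    · simp only [Function.update_self]
      exact hD.pos_lt hrE
    · simp only [Function.update_self, and_self, or_true]

/-- Working for page `p`. -/
theorem advance_spec (hD : D.Valid a pg σ lam) {s : ReplayState n} (hs : Inv a pg D s) {p : Fin n}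
    (hp : s.coord p < D.pos p (s.lst p)) :
    Inv a pg D (advance D s p) ∧ s.time < (advance D s p).time ∧
      (advance D s p).time ≤ nextTime D s.time ∧
      (advance D s p).fst = s.fst ∧ (advance D s p).lst = s.lst ∧
      (advance D s p).coord p = s.coord p + ((advance D s p).time - s.time) ∧
      (∀ q, q ≠ p → (advance D s p).coord q = s.coord q ∧
        (advance D s p).served q = s.served q) ∧
      ((advance D s p).coord p = D.pos p (s.lst p) ∧ (advance D s p).served p = s.lst p ∨
        (advance D s p).coord p < D.pos p (s.lst p) ∧ (advance D s p).served p = s.served p ∧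
        (advance D s p).time = nextTime D s.time) := by
  classical
  have hnt := lt_nextTime (D := D) s.time
  obtain ⟨r, hrE, hrp, hfst, hlst, hserved, hfc⟩ := hs.window p hp
  by_cases hc : s.time + (D.pos p (s.lst p) - s.coord p) ≤ nextTime D s.time
  · have e : advance D s p = { s with
        time := s.time + (D.pos p (s.lst p) - s.coord p)
        coord := Function.update s.coord p (D.pos p (s.lst p))
        served := Function.update s.served p (s.lst p) } := by
      unfold advance
      rw [if_pos hc]
    have htm : s.time ≤ s.time + (D.pos p (s.lst p) - s.coord p) := by linarith
    rw [e]
    refine ⟨⟨hs.time_nonneg.trans htm, fun q => ?_, fun q => ?_, fun q => ?_, fun q => ?_,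
      fun i hi => ?_⟩, ?_, hc, rfl, rfl, ?_, fun q hq => ?_, ?_⟩
    · by_cases hq : q = p
      · subst hq
        simp only [Function.update_self]
        exact (hs.coord_nonneg q).trans hp.le
      · simp only [Function.update_of_ne hq]
        exact hs.coord_nonneg q
    · by_cases hq : q = p
      · subst hq
        simp only [Function.update_self]
        exact hD.pos_mono _ ((hs.lst_le q).trans htm)
      · simp only [Function.update_of_ne hq]
        exact (hs.coord_le q).trans (hD.pos_mono _ htm)
    · exact (hs.lst_le q).trans htm
    · by_cases hq : q = p
      · subst hq
        simp only [Function.update_self]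
        intro h
        exact absurd h (lt_irrefl _)
      · simp only [Function.update_of_ne hq]
        exact hs.window q
    · by_cases hq : pg i = p
      · simp only [hq, Function.update_self]
        intro h _
        -- After the broadcast ends, the coordinate is the clock position of `served`, and unserved
        -- requests arrived later than that.
        exact hD.pos_mono _ h.le
      · simp only [Function.update_of_ne hq]
        exact hs.idle i hi
    · show s.time < s.time + (D.pos p (s.lst p) - s.coord p)
      linarith
    · simp only [Function.update_self]
      ring
    · simp only [Function.update_of_ne hq, and_self]
    · simp only [Function.update_self, and_self, true_or]
  · have e : advance D s p = { s with
        time := nextTime D s.time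
        coord := Function.update s.coord p (s.coord p + (nextTime D s.time - s.time)) } := by
      unfold advance
      rw [if_neg hc]
    rw [not_le] at hc
    have hlt : s.coord p + (nextTime D s.time - s.time) < D.pos p (s.lst p) := by linarith
    have hle : s.coord p ≤ s.coord p + (nextTime D s.time - s.time) := by linarith
    rw [e]
    refine ⟨⟨hs.time_nonneg.trans hnt.le, fun q => ?_, fun q => ?_, fun q => ?_, fun q => ?_,
      fun i hi => ?_⟩, hnt, le_rfl, rfl, rfl, ?_, fun q hq => ?_, ?_⟩
    · by_cases hq : q = p
      · subst hq
        simp only [Function.update_self]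
        exact (hs.coord_nonneg q).trans hle
      · simp only [Function.update_of_ne hq]
        exact hs.coord_nonneg q
    · by_cases hq : q = p
      · subst hq
        simp only [Function.update_self]
        exact hlt.le.trans (hD.pos_mono _ ((hs.lst_le q).trans hnt.le))
      · simp only [Function.update_of_ne hq]
        exact (hs.coord_le q).trans (hD.pos_mono _ hnt.le)
    · exact (hs.lst_le q).trans hnt.le
    · by_cases hq : q = p
      · subst hq
        simp only [Function.update_self]
        intro _
        exact ⟨r, hrE, hrp, hfst, hlst, hserved, hfc.trans hle⟩
      · simp only [Function.update_of_ne hq]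
        exact hs.window q
    · by_cases hq : pg i = p
      · simp only [hq, Function.update_self]
        intro _ h
        exact absurd h (not_le.2 hlt)
      · simp only [Function.update_of_ne hq]
        exact hs.idle i hi
    · simp only [Function.update_self]
    · simp only [Function.update_of_ne hq, and_self]
    · simp only [Function.update_self, and_self, and_true]
      exact Or.inr hlt

theorem step_none {s : ReplayState n} (h : pick a pg D s = none) :
    step a pg D s = { s with time := nextTime D s.time } := by
  simp only [step, h]

theorem step_some {s : ReplayState n} {r : ι} (h : pick a pg D s = some r) :
    step a pg D s = advance D (start a pg D s r) (pg r) := by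
  simp only [step, h]

/-- The last alternative measures progress: each step reaches `nextTime` or serves a new request. -/
theorem step_spec (hD : D.Valid a pg σ lam) {s : ReplayState n} (hs : Inv a pg D s) :
    Inv a pg D (step a pg D s) ∧ s.time < (step a pg D s).time ∧
      (step a pg D s).time ≤ nextTime D s.time ∧
      (∀ p, s.coord p ≤ (step a pg D s).coord p) ∧
      (∀ p, s.served p ≤ (step a pg D s).served p) ∧
      ((step a pg D s).time = nextTime D s.time ∨
        ∃ r ∈ D.E, s.served (pg r) < a r ∧ a r ≤ (step a pg D s).served (pg r)) := by
  rcases hr : pick a pg D s with _ | r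
  · rw [step_none hr]
    have hnt := lt_nextTime (D := D) s.time
    refine ⟨⟨hs.time_nonneg.trans hnt.le, hs.coord_nonneg, fun p => ?_, fun p => ?_, hs.window,
      hs.idle⟩, hnt, le_rfl, fun _ => le_rfl, fun _ => le_rfl, Or.inl rfl⟩
    · exact (hs.coord_le p).trans (hD.pos_mono _ hnt.le)
    · exact (hs.lst_le p).trans hnt.le
  · rw [step_some hr]
    obtain ⟨h1, h2, h3, h4, h5, h6, h7, h8⟩ := start_spec hD hs hr
    obtain ⟨g1, g2, g3, g4, g5, g6, g7, g8⟩ := advance_spec hD h1 h7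
    obtain ⟨⟨hrE, hrb, hra⟩, -⟩ := pick_eq_some hr
    obtain ⟨i, hiE, hip, hif, hil, his, hic⟩ := h1.window _ h7
    rw [h2] at g2 g3 g6
    rw [h3] at his
    refine ⟨g1, g2, g3, fun p => ?_, fun p => ?_, ?_⟩
    · by_cases hp : p = pg r
      · subst hp
        rw [g6]
        linarith [h4 (pg r)]
      · rw [(g7 p hp).1]
        exact h4 p
    · by_cases hp : p = pg r
      · subst hp
        rcases g8 with h | h
        · rw [h.2]
          exact his.le
        · rw [h.2.1, h3]
      · rw [(g7 p hp).2, h3]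
    · rcases g8 with h | h
      · refine Or.inr ⟨r, hrE, hra, ?_⟩
        rw [h.2]
        -- The broadcast serves `r` because `pos (a r) ≤ coord < pos lst` forces `a r ≤ lst`.
        by_contra hc
        exact absurd (hD.pos_mono (pg r) (not_le.1 hc).le) (not_le.2 (h6.trans_lt h7))
      · left
        rw [h.2.2, h2]

theorem inv_run (hD : D.Valid a pg σ lam) (j : ℕ) : Inv a pg D (run a pg D j) := by
  induction j with
  | zero =>
    refine ⟨le_rfl, fun _ => le_rfl, fun p => (Trace.pos_zero p).ge, fun _ => le_rfl, fun p h => ?_,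
      fun i hi _ _ => ?_⟩
    · exact absurd (h.trans_eq (Trace.pos_zero p)) (lt_irrefl (0 : ℝ))
    · exact (Trace.pos_zero (pg i)).ge.trans (hD.pos_mono _ (hD.nonneg i))
  | succ j ih => exact (step_spec hD ih).1

theorem time_strictMono (hD : D.Valid a pg σ lam) : StrictMono fun j => (run a pg D j).time :=
  strictMono_nat_of_lt_succ fun j => (step_spec hD (inv_run hD j)).2.1

theorem served_mono (hD : D.Valid a pg σ lam) (p : Fin n) :
    Monotone fun j => (run a pg D j).served p :=
  monotone_nat_of_le_succ fun j => (step_spec hD (inv_run hD j)).2.2.2.2.1 p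

-- Events do not accumulate: every step lengthens time by one, passes a new fractional completion,
-- or serves a new request, and the last two happen at most `|E|` times each.
open Classical in
theorem le_time (hD : D.Valid a pg σ lam) (j : ℕ) : (j : ℝ) ≤ (run a pg D j).time +
    (D.E.filter fun i => D.b i ≤ (run a pg D j).time).card +
    (D.E.filter fun i => a i ≤ (run a pg D j).served (pg i)).card := by
  induction j with
  | zero =>
    have : (0 : ℝ) ≤ (run a pg D 0).time := le_rfl
    push_cast
    positivity
  | succ j ih =>
    obtain ⟨-, h2, -, -, h5, h6⟩ := step_spec hD (inv_run hD j)
    change _ < (run a pg D (j + 1)).time at h2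
    change ∀ p, _ ≤ (run a pg D (j + 1)).served p at h5
    have c1 : D.E.filter (fun i => D.b i ≤ (run a pg D j).time) ⊆
        D.E.filter (fun i => D.b i ≤ (run a pg D (j + 1)).time) := fun i hi => by
      rw [Finset.mem_filter] at hi ⊢
      exact ⟨hi.1, hi.2.trans h2.le⟩
    have c2 : D.E.filter (fun i => a i ≤ (run a pg D j).served (pg i)) ⊆
        D.E.filter (fun i => a i ≤ (run a pg D (j + 1)).served (pg i)) := fun i hi => by
      rw [Finset.mem_filter] at hi ⊢
      exact ⟨hi.1, hi.2.trans (h5 _)⟩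
    have d1 : ((D.E.filter (fun i => D.b i ≤ (run a pg D j).time)).card : ℝ) ≤
        (D.E.filter (fun i => D.b i ≤ (run a pg D (j + 1)).time)).card := by
      exact_mod_cast Finset.card_le_card c1
    have d2 : ((D.E.filter (fun i => a i ≤ (run a pg D j).served (pg i))).card : ℝ) ≤
        (D.E.filter (fun i => a i ≤ (run a pg D (j + 1)).served (pg i))).card := by
      exact_mod_cast Finset.card_le_card c2
    push_cast
    rcases h6 with h6 | ⟨r, hrE, hr1, hr2⟩
    · change (run a pg D (j + 1)).time = _ at h6
      rcases nextTime_eq (D := D) (run a pg D j).time with h7 | ⟨i, hi, hi1, hi2⟩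
      · linarith
      · have : (D.E.filter (fun i => D.b i ≤ (run a pg D j).time)).card <
            (D.E.filter (fun i => D.b i ≤ (run a pg D (j + 1)).time)).card := by
          refine Finset.card_lt_card (Finset.ssubset_iff_of_subset c1 |>.2 ⟨i, ?_, ?_⟩)
          · rw [Finset.mem_filter]
            exact ⟨hi, (h6.trans hi2).ge⟩
          · rw [Finset.mem_filter]
            rintro ⟨-, h⟩
            exact absurd h (not_le.2 hi1)
        have : ((D.E.filter (fun i => D.b i ≤ (run a pg D j).time)).card : ℝ) + 1 ≤
            (D.E.filter (fun i => D.b i ≤ (run a pg D (j + 1)).time)).card := by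
          exact_mod_cast this
        linarith
    · have : (D.E.filter (fun i => a i ≤ (run a pg D j).served (pg i))).card <
          (D.E.filter (fun i => a i ≤ (run a pg D (j + 1)).served (pg i))).card := by
        refine Finset.card_lt_card (Finset.ssubset_iff_of_subset c2 |>.2 ⟨r, ?_, ?_⟩)
        · rw [Finset.mem_filter]
          exact ⟨hrE, hr2⟩
        · rw [Finset.mem_filter]
          rintro ⟨-, h⟩
          exact absurd h (not_le.2 hr1)
      have : ((D.E.filter (fun i => a i ≤ (run a pg D j).served (pg i))).card : ℝ) + 1 ≤
          (D.E.filter (fun i => a i ≤ (run a pg D (j + 1)).served (pg i))).card := by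
        exact_mod_cast this
      linarith

theorem exists_lt_time (hD : D.Valid a pg σ lam) (t : ℝ) : ∃ j, t < (run a pg D j).time := by
  classical
  obtain ⟨j, hj⟩ := exists_nat_gt (t + D.E.card + D.E.card)
  refine ⟨j, ?_⟩
  have h := le_time hD j
  have h1 : ((D.E.filter fun i => D.b i ≤ (run a pg D j).time).card : ℝ) ≤ D.E.card := by
    exact_mod_cast Finset.card_filter_le _ _
  have h2 : ((D.E.filter fun i => a i ≤ (run a pg D j).served (pg i)).card : ℝ) ≤ D.E.card := by
    exact_mod_cast Finset.card_filter_le _ _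
  linarith

end Replay

/-! ### The delay of the replay, by a busy-period argument -/

section Busy

variable {ι : Type*} {n : ℕ} {a : ι → ℝ} {pg : ι → Fin n} {D : Trace ι n}
  {σ : Fin n → ℝ≥0} {lam : ℝ≥0}

variable (a pg D) in
/-- In step `j` the integral schedule works for a request of fractional flow time at most `w`. -/
def Busy (w : ℝ) (j : ℕ) : Prop := ∃ i, pick a pg D (run a pg D j) = some i ∧ D.b i - a i ≤ w

/-- No step jumps over a fractional completion, since `nextTime` stops at each of them. -/
theorem exists_time_eq (hD : D.Valid a pg σ lam) {r : ι} (hr : r ∈ D.E) :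
    ∃ j, (run a pg D j).time = D.b r := by
  classical
  have hex : ∃ j, D.b r ≤ (run a pg D j).time := (exists_lt_time hD (D.b r)).imp fun _ h => h.le
  refine ⟨Nat.find hex, le_antisymm ?_ (Nat.find_spec hex)⟩
  rcases h : Nat.find hex with _ | k
  · exact (hD.b_pos hr).le
  · have hk : (run a pg D k).time < D.b r := not_le.1 (Nat.find_min hex (by omega))
    exact (step_spec hD (inv_run hD k)).2.2.1.trans (nextTime_le hr hk)

theorem busy_of_mem_queue {w : ℝ} {j : ℕ} {i : ι}
    (hi : i ∈ queue a pg D (run a pg D j)) (hw : D.b i - a i ≤ w) : Busy a pg D w j := by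
  rcases hr : pick a pg D (run a pg D j) with _ | r
  · have := pickMin_eq_none hr
    rw [this] at hi
    simp at hi
  · exact ⟨r, hr, ((pick_eq_some hr).2 i hi).trans hw⟩

/-- While only requests whose window starts after time `x` are worked for, each step advances the
replay of a page within the part after time `x`. -/
theorem time_sub_le (hD : D.Valid a pg σ lam) {x : ℝ} {j₀ m : ℕ} (hm : j₀ ≤ m)
    (h : ∀ j, j₀ ≤ j → j < m → ∃ i, pick a pg D (run a pg D j) = some i ∧ x ≤ a i) :
    (run a pg D m).time - (run a pg D j₀).time ≤
      ∑ p, (max ((run a pg D m).coord p) (D.pos p x) - D.pos p x) := by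
  induction m, hm using Nat.le_induction with
  | base =>
    rw [sub_self]
    exact Finset.sum_nonneg fun p _ => sub_nonneg.2 (le_max_right _ _)
  | succ m hm ih =>
    have ih' := ih fun j h1 h2 => h j h1 (by omega)
    obtain ⟨i, hi, hxi⟩ := h m hm (by omega)
    obtain ⟨h1, h2, h3, h4, h5, h6, h7, h8⟩ := start_spec hD (inv_run hD m) hi
    obtain ⟨g1, g2, g3, g4, g5, g6, g7, g8⟩ := advance_spec hD h1 h7
    have e : run a pg D (m + 1) = advance D (start a pg D (run a pg D m) i) (pg i) := step_some hi
    rw [← e] at g2 g6 g7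
    rw [h2] at g2 g6
    have key : ∀ p, (max ((run a pg D m).coord p) (D.pos p x) - D.pos p x) +
        (if p = pg i then (run a pg D (m + 1)).time - (run a pg D m).time else 0) ≤
        max ((run a pg D (m + 1)).coord p) (D.pos p x) - D.pos p x := by
      intro p
      split_ifs with hp
      · subst hp
        have h9 := hD.pos_mono (pg i) hxi
        -- A jump of the coordinate costs no time, and the worked stretch lies beyond both the old
        -- coordinate and the clock position of `x`; so it is counted in full.
        have h10 : max ((run a pg D m).coord (pg i)) (D.pos (pg i) x) ≤
            (start a pg D (run a pg D m) i).coord (pg i) := max_le (h4 _) (h9.trans h6)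
        have h11 := le_max_left ((run a pg D (m + 1)).coord (pg i)) (D.pos (pg i) x)
        linarith
      · have := max_le_max (h4 p) (le_refl (D.pos p x))
        rw [(g7 p hp).1]
        linarith
    have := Finset.sum_le_sum fun p (_ : p ∈ Finset.univ) => key p
    rw [Finset.sum_add_distrib, Finset.sum_ite_eq' Finset.univ (pg i)] at this
    simp only [Finset.mem_univ, if_true] at this
    linarith

/-- The delay of a request in the integral schedule. -/
theorem exists_served (hD : D.Valid a pg σ lam) {r : ι} (hr : r ∈ D.E) :
    ∃ j, a r ≤ (run a pg D j).served (pg r) ∧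
      (run a pg D j).time ≤ D.b r + lam / (1 - lam) * (D.b r - a r) := by
  classical
  set w := D.b r - a r with hw
  have hw0 : 0 < w := sub_pos.2 (hD.lt r hr)
  have hlam : 0 < (1 : ℝ) - lam := sub_pos.2 (by exact_mod_cast hD.lam_lt)
  obtain ⟨jr, hjr⟩ := exists_time_eq hD hr
  have hmono := (time_strictMono hD).monotone
  have hex : ∃ k, ∀ j, k ≤ j → j < jr → Busy a pg D w j := ⟨jr, fun j h1 h2 => by omega⟩
  -- `j₀` starts the maximal run of busy steps that leads up to the completion of `r`.
  set j₀ := Nat.find hex with hj₀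
  have hb₀ : ∀ j, j₀ ≤ j → j < jr → Busy a pg D w j := Nat.find_spec hex
  have hj₀r : j₀ ≤ jr := Nat.find_min' hex fun j h1 h2 => by omega
  have htr : (run a pg D j₀).time ≤ D.b r := hjr ▸ hmono hj₀r
  -- A request of flow at most `w` completed before the busy period would have been in the queue one
  -- step earlier, extending the period. So all work in the period is for windows that begin no
  -- earlier than `time j₀ - w`.
  have hstart : ∀ j, j₀ ≤ j → ∀ i ∈ queue a pg D (run a pg D j), D.b i - a i ≤ w →
      (run a pg D j₀).time ≤ D.b i := by
    intro j hj i hi hiw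
    obtain ⟨hiE, hib, hia⟩ := mem_queue.1 hi
    rcases hz : j₀ with _ | k
    · exact (hD.b_pos hiE).le
    · by_contra hc
      have hik : D.b i ≤ (run a pg D k).time := by
        by_contra hc2
        exact hc ((step_spec hD (inv_run hD k)).2.2.1.trans (nextTime_le hiE (not_le.1 hc2)))
      have hiq : i ∈ queue a pg D (run a pg D k) :=
        mem_queue.2 ⟨hiE, hik, (served_mono hD (pg i) (by omega : k ≤ j)).trans_lt hia⟩
      have hbk := busy_of_mem_queue hiq hiw
      refine absurd (Nat.find_min hex (m := k) (by omega)) (not_not.2 ?_)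
      intro j' h1 h2
      rcases h1.eq_or_lt with rfl | h1
      · exact hbk
      · exact hb₀ j' (by omega) h2
  have hbound : ∀ m, j₀ ≤ m → (∀ j, j₀ ≤ j → j < m → Busy a pg D w j) →
      (run a pg D m).time ≤ D.b r + lam / (1 - lam) * w := by
    intro m hm hbusy
    have h1 := time_sub_le hD (x := (run a pg D j₀).time - w) hm fun j hj1 hj2 => by
      obtain ⟨i, hi, hiw⟩ := hbusy j hj1 hj2
      refine ⟨i, hi, ?_⟩
      have := hstart j hj1 i (mem_queue.2 (pick_eq_some hi).1) hiw
      linarith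
    have hx : (run a pg D j₀).time - w ≤ (run a pg D m).time := by
      have : (run a pg D j₀).time ≤ (run a pg D m).time := hmono hm
      linarith
    have h2 : ∑ p, (max ((run a pg D m).coord p) (D.pos p ((run a pg D j₀).time - w)) -
        D.pos p ((run a pg D j₀).time - w)) ≤
        ∑ p, (D.pos p (run a pg D m).time - D.pos p ((run a pg D j₀).time - w)) := by
      refine Finset.sum_le_sum fun p _ => sub_le_sub_right (max_le ?_ ?_) _
      · exact (inv_run hD m).coord_le p
      · exact hD.pos_mono p hx
    have h3 := sum_clock_sub_le hD.measurable_share hD.lam_lt.le hD.sum_le hx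
    have h4 := h1.trans (h2.trans h3)
    -- With `L` the length of the period, the work done is `L` and the work available is at most
    -- `lam * (L + w)`.
    have h5 : (run a pg D m).time - (run a pg D j₀).time ≤ lam / (1 - lam) * w := by
      rw [div_mul_eq_mul_div, le_div_iff₀ hlam]
      nlinarith
    linarith
  -- While `r` itself is waiting every step is busy, so if it were never served the bound would hold
  -- at all later times.
  have hdone : ∃ j, jr ≤ j ∧ a r ≤ (run a pg D j).served (pg r) := by
    by_contra! hc
    obtain ⟨m, hm⟩ := exists_lt_time hD (D.b r + lam / (1 - lam) * w)
    have h1 : (run a pg D m).time ≤ (run a pg D (max m jr)).time := hmono (le_max_left _ _)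
    have h2 := hbound (max m jr) (hj₀r.trans (le_max_right _ _)) fun j hj1 hj2 => by
      rcases lt_or_ge j jr with h | h
      · exact hb₀ j hj1 h
      · refine busy_of_mem_queue (mem_queue.2 ⟨hr, ?_, hc j h⟩) le_rfl
        rw [← hjr]
        exact hmono h
    linarith
  refine ⟨Nat.find hdone, (Nat.find_spec hdone).2, ?_⟩
  refine hbound _ (hj₀r.trans (Nat.find_spec hdone).1) fun j hj1 hj2 => ?_
  rcases lt_or_ge j jr with h | h
  · exact hb₀ j hj1 h
  · refine busy_of_mem_queue (mem_queue.2 ⟨hr, ?_, ?_⟩) le_rfl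
    · rw [← hjr]
      exact hmono h
    · by_contra hc
      exact Nat.find_min hdone hj2 ⟨h, not_lt.1 hc⟩

end Busy

/-! ### Sequential reception of a page -/

section Received

variable {n : ℕ}

/-- During `[x, T)`, an amount `V` of page `p` is received in sequential order. -/
def Received (S : Schedule n) (p : Fin n) (x T : ℝ) (V : ℝ≥0∞) : Prop :=
  ∃ R : Set ℝ, MeasurableSet R ∧ R ⊆ Ico x T ∧ (∀ t ∈ R, S.page t = some p) ∧
    (∀ t ∈ R, (S.pos t : ℝ≥0∞) = ∫⁻ τ in R ∩ Iic t, (S.speed τ : ℝ≥0∞)) ∧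
    ∫⁻ τ in R, (S.speed τ : ℝ≥0∞) = V

variable {S : Schedule n} {p : Fin n} {x T T' : ℝ}

theorem Received.zero : Received S p x T 0 :=
  ⟨∅, MeasurableSet.empty, empty_subset _, by simp, by simp, by simp⟩

theorem Received.mono {V : ℝ≥0∞} {x' : ℝ} (h : Received S p x T V) (hx : x' ≤ x) (hT : T ≤ T') :
    Received S p x' T' V := by
  obtain ⟨R, h1, h2, h3⟩ := h
  exact ⟨R, h1, h2.trans (Ico_subset_Ico hx hT), h3⟩

theorem lintegral_Ico_add (g : ℝ → ℝ≥0∞) {c d e : ℝ} (h1 : c ≤ d) (h2 : d ≤ e) :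
    (∫⁻ t in Ico c d, g t) + ∫⁻ t in Ico d e, g t = ∫⁻ t in Ico c e, g t := by
  rw [← lintegral_union measurableSet_Ico, Ico_union_Ico_eq_Ico h1 h2]
  rw [disjoint_left]
  intro t ht ht'
  exact absurd ht.2 (not_lt.2 ht'.1)

/-- A preempted broadcast may be resumed: if sending continues at the position reached, the new
stretch is appended to the set of reception times. -/
theorem Received.extend {c θ : ℝ} {g : ℝ → ℝ≥0∞}
    (h : Received S p x T (∫⁻ t in Ico c θ, g t)) (hxT : x ≤ T) (hTT : T ≤ T') (hc : c ≤ θ)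
    (hpage : ∀ t ∈ Ico T T', S.page t = some p)
    (hspeed : ∀ t ∈ Ico T T', (S.speed t : ℝ≥0∞) = g (θ + (t - T)))
    (hpos : ∀ t ∈ Ico T T', (S.pos t : ℝ≥0∞) = ∫⁻ u in Ico c (θ + (t - T)), g u) :
    Received S p x T' (∫⁻ t in Ico c (θ + (T' - T)), g t) := by
  obtain ⟨R, h1, h2, h3, h4, h5⟩ := h
  have key : ∀ t, T ≤ t → t ≤ T' →
      (∫⁻ τ in R, (S.speed τ : ℝ≥0∞)) + ∫⁻ τ in Ico T t, (S.speed τ : ℝ≥0∞) =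
      ∫⁻ u in Ico c (θ + (t - T)), g u := by
    intro t ht ht'
    rw [← lintegral_Ico_add g hc (by linarith : θ ≤ θ + (t - T)), h5]
    congr 1
    rw [← lintegral_Ico_translate]
    exact setLIntegral_congr_fun measurableSet_Ico fun u hu => hspeed u ⟨hu.1, hu.2.trans_le ht'⟩
  have hdisj : ∀ t, Disjoint R (Ico T t) := fun t => by
    rw [disjoint_left]
    intro u hu hu'
    exact absurd (h2 hu).2 (not_lt.2 hu'.1)
  refine ⟨R ∪ Ico T T', h1.union measurableSet_Ico, union_subset (h2.trans (Ico_subset_Ico_right hTT))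
    (Ico_subset_Ico_left hxT), ?_, ?_, ?_⟩
  · rintro t (ht | ht)
    · exact h3 t ht
    · exact hpage t ht
  · rintro t (ht | ht)
    · rw [h4 t ht]
      have : (R ∪ Ico T T') ∩ Iic t = R ∩ Iic t := by
        ext u
        simp only [mem_inter_iff, mem_union, mem_Ico, mem_Iic]
        constructor
        · rintro ⟨h | h, h'⟩
          · exact ⟨h, h'⟩
          · exact absurd (h.1.trans h') (not_le.2 (h2 ht).2)
        · rintro ⟨h, h'⟩
          exact ⟨Or.inl h, h'⟩
      rw [this]
    · have : (R ∪ Ico T T') ∩ Iic t = R ∪ Icc T t := by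
        ext u
        simp only [mem_inter_iff, mem_union, mem_Ico, mem_Iic, mem_Icc]
        constructor
        · rintro ⟨h | h, h'⟩
          · exact Or.inl h
          · exact Or.inr ⟨h.1, h'⟩
        · rintro (h | h)
          · exact ⟨Or.inl h, (h2 h).2.le.trans ht.1⟩
          · exact ⟨Or.inr ⟨h.1, h.2.trans_lt ht.2⟩, h.2⟩
      -- Positions count what is received up to and including `t`, while the stretches are
      -- half-open; the difference is null.
      have hae : (R ∪ Icc T t : Set ℝ) =ᵐ[volume] (R ∪ Ico T t : Set ℝ) :=
        (Filter.EventuallyEq.refl _ R).union Ico_ae_eq_Icc.symm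
      rw [hpos t ht, this, setLIntegral_congr hae, lintegral_union measurableSet_Ico (hdisj t),
        key t ht.1 ht.2.le]
  · rw [lintegral_union measurableSet_Ico (hdisj T'), key T' hTT le_rfl]

theorem Received.satisfiedBy {σ : Fin n → ℝ≥0} {r : Request n}
    (h : Received S r.page r.arrival T (σ r.page)) : S.SatisfiedBy σ r T := by
  obtain ⟨R, h1, h2, h3⟩ := h
  exact ⟨R, h1, h2.trans Ico_subset_Icc_self, h3⟩

end Received

/-! ### The integral schedule, its deliveries and its energy -/

section Output

variable {ι : Type*} {n : ℕ} (a : ι → ℝ) (pg : ι → Fin n) (D : Trace ι n)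

/-- The number of events up to time `t`. -/
def idx (t : ℝ) : ℕ := sInf {j | t < (run a pg D (j + 1)).time}

/-- The page that is sent in state `s`. -/
def outPage (s : ReplayState n) : Option (Fin n) := (pick a pg D s).map pg

/-- The position within the page that is sent in state `s`, at time `t`. -/
def outPos (s : ReplayState n) (t : ℝ) : ℝ≥0 :=
  match pick a pg D s with
  | none => 0
  | some r => (∫⁻ θ in Ico (D.pos (pg r) ((start a pg D s r).fst (pg r)))
      ((start a pg D s r).coord (pg r) + (t - s.time)),
      (D.v (unclock (D.φ (pg r)) θ) : ℝ≥0∞)).toNNReal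

/-- The rate at which the page is sent in state `s`, at time `t`. -/
def outSpeed (s : ReplayState n) (t : ℝ) : ℝ≥0 :=
  match pick a pg D s with
  | none => 0
  | some r => D.v (unclock (D.φ (pg r)) ((start a pg D s r).coord (pg r) + (t - s.time)))

variable {a pg D} {σ : Fin n → ℝ≥0} {lam : ℝ≥0}

theorem idx_nonempty (hD : D.Valid a pg σ lam) (t : ℝ) :
    {j | t < (run a pg D (j + 1)).time}.Nonempty := by
  obtain ⟨j, hj⟩ := exists_lt_time hD t
  exact ⟨j, hj.trans (time_strictMono hD (Nat.lt_succ_self j))⟩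

theorem lt_time_idx (hD : D.Valid a pg σ lam) (t : ℝ) :
    t < (run a pg D (idx a pg D t + 1)).time := Nat.sInf_mem (idx_nonempty hD t)

theorem time_idx_le {t : ℝ} (ht : 0 ≤ t) : (run a pg D (idx a pg D t)).time ≤ t := by
  rcases h : idx a pg D t with _ | k
  · exact ht
  · have : k ∉ {j | t < (run a pg D (j + 1)).time} := Nat.notMem_of_lt_sInf (by
      rw [← idx, h]
      omega)
    exact not_lt.1 this

theorem idx_eq (hD : D.Valid a pg σ lam) {j : ℕ} {t : ℝ}
    (ht : t ∈ Ico (run a pg D j).time (run a pg D (j + 1)).time) : idx a pg D t = j := by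
  have h0 : 0 ≤ t := (inv_run hD j).time_nonneg.trans ht.1
  refine le_antisymm (Nat.sInf_le ht.2) ?_
  by_contra hc
  have h1 := (time_strictMono hD).monotone (by omega : idx a pg D t + 1 ≤ j)
  have h2 := lt_time_idx hD t
  exact absurd (h2.trans_le h1) (not_lt.2 ht.1)

theorem monotone_idx (hD : D.Valid a pg σ lam) : Monotone (idx a pg D) := fun _ _ h =>
  Nat.sInf_le (h.trans_lt (lt_time_idx hD _))

theorem measurable_comp_idx (hD : D.Valid a pg σ lam) {β : Type*} [MeasurableSpace β]
    {F : ℕ → ℝ → β} (hF : ∀ j, Measurable (F j)) : Measurable fun t => F (idx a pg D t) t := by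
  have h1 : Measurable fun x : ℕ × ℝ => F x.1 x.2 := measurable_from_prod_countable_right hF
  exact h1.comp ((monotone_idx hD).measurable.prodMk measurable_id)

theorem measurable_outPos (s : ReplayState n) : Measurable (outPos a pg D s) := by
  unfold outPos
  rcases pick a pg D s with _ | r
  · exact measurable_const
  · refine Measurable.ennreal_toNNReal (Monotone.measurable fun t t' h => ?_)
    exact lintegral_mono_set (Ico_subset_Ico_right (by linarith))

theorem measurable_outSpeed (hD : D.Valid a pg σ lam) (s : ReplayState n) :
    Measurable (outSpeed a pg D s) := by
  unfold outSpeed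
  rcases pick a pg D s with _ | r
  · exact measurable_const
  · exact (hD.measurable_replay (pg r)).comp
      ((measurable_id.sub_const _).const_add _)

/-- The integral schedule. -/
def replaySchedule (hD : D.Valid a pg σ lam) : Schedule n where
  page t := outPage a pg D (run a pg D (idx a pg D t))
  pos t := outPos a pg D (run a pg D (idx a pg D t)) t
  speed t := outSpeed a pg D (run a pg D (idx a pg D t)) t
  measurableSet_page p := by
    have : MeasurableSet (idx a pg D ⁻¹' {j | outPage a pg D (run a pg D j) = some p}) :=
      (monotone_idx hD).measurable (MeasurableSet.of_discrete)
    exact this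
  measurable_pos := measurable_comp_idx hD fun j => measurable_outPos (run a pg D j)
  measurable_speed := measurable_comp_idx hD fun j => measurable_outSpeed hD (run a pg D j)

theorem lintegral_window (hD : D.Valid a pg σ lam) {s : ReplayState n} (hs : Inv a pg D s)
    {p : Fin n} (hp : s.coord p < D.pos p (s.lst p)) :
    ∫⁻ θ in Ico (D.pos p (s.fst p)) (D.pos p (s.lst p)), (D.v (unclock (D.φ p) θ) : ℝ≥0∞) = σ p := by
  obtain ⟨i, hi, rfl, h1, h2, -⟩ := hs.window p hp
  rw [h1, h2]
  exact hD.lintegral_replay hi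

/-- What is received in one step. -/
theorem received_step (hD : D.Valid a pg σ lam) {j : ℕ} {r : ι}
    (hr : pick a pg D (run a pg D j) = some r)
    (ih : (run a pg D j).coord (pg r) < D.pos (pg r) ((run a pg D j).lst (pg r)) →
      Received (replaySchedule hD) (pg r) ((run a pg D j).lst (pg r)) (run a pg D j).time
        (∫⁻ θ in Ico (D.pos (pg r) ((run a pg D j).fst (pg r))) ((run a pg D j).coord (pg r)),
          (D.v (unclock (D.φ (pg r)) θ) : ℝ≥0∞))) :
    Received (replaySchedule hD) (pg r) ((run a pg D (j + 1)).lst (pg r)) (run a pg D (j + 1)).time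
      (∫⁻ θ in Ico (D.pos (pg r) ((run a pg D (j + 1)).fst (pg r)))
        ((run a pg D (j + 1)).coord (pg r)), (D.v (unclock (D.φ (pg r)) θ) : ℝ≥0∞)) := by
  obtain ⟨h1, h2, h3, h4, h5, h6, h7, h8⟩ := start_spec hD (inv_run hD j) hr
  obtain ⟨g1, g2, g3, g4, g5, g6, g7, g8⟩ := advance_spec hD h1 h7
  have e : run a pg D (j + 1) = advance D (start a pg D (run a pg D j) r) (pg r) := step_some hr
  rw [← e] at g1 g2 g3 g4 g5 g6 g7 g8
  set p := pg r with hp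
  set s := run a pg D j with hs
  set s1 := start a pg D s r with hs1
  set s' := run a pg D (j + 1) with hs'
  rw [h2] at g2 g6
  have hwin := lintegral_window hD h1 h7
  have hcf : D.pos p (s1.fst p) ≤ s1.coord p := by
    obtain ⟨i, hi, -, -, -, -, hh⟩ := h1.window p h7
    exact hh
  have hcl : s1.coord p + (s'.time - s.time) ≤ D.pos p (s1.lst p) := by
    rw [← g6]
    rcases g8 with h | h
    · exact h.1.le
    · exact h.1.le
  -- Either the old broadcast is continued, with what it has delivered, or a new one starts with
  -- nothing delivered.
  have hbase : Received (replaySchedule hD) p (s1.lst p) s.time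
      (∫⁻ θ in Ico (D.pos p (s1.fst p)) (s1.coord p), (D.v (unclock (D.φ p) θ) : ℝ≥0∞)) := by
    rcases h8 with ⟨k1, k2, k3, k4⟩ | ⟨k1, k2, k3⟩
    · rw [k1, k2, k3]
      exact ih k4
    · rw [k1, k2, Ico_self]
      simpa using Received.zero
  rw [g4, g5, g6]
  have hl : s1.lst p ≤ s.time := by
    rw [← h2]
    exact h1.lst_le p
  refine hbase.extend hl g2.le hcf (fun t ht => ?_) (fun t ht => ?_) (fun t ht => ?_)
  · show outPage a pg D (run a pg D (idx a pg D t)) = _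
    rw [idx_eq hD ht, outPage, hr]
    rfl
  · show ((outSpeed a pg D (run a pg D (idx a pg D t)) t : ℝ≥0) : ℝ≥0∞) = _
    rw [idx_eq hD ht]
    simp only [outSpeed, ← hs, hr, ← hp, ← hs1]
  · show ((outPos a pg D (run a pg D (idx a pg D t)) t : ℝ≥0) : ℝ≥0∞) = _
    rw [idx_eq hD ht]
    simp only [outPos, ← hs, hr, ← hp, ← hs1]
    refine ENNReal.coe_toNNReal (ne_top_of_le_ne_top (ENNReal.coe_ne_top (r := σ p)) ?_)
    rw [← hwin]
    exact lintegral_mono_set (Ico_subset_Ico_right (by linarith [ht.2]))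

theorem received_window (hD : D.Valid a pg σ lam) (j : ℕ) (p : Fin n)
    (hp : (run a pg D j).coord p < D.pos p ((run a pg D j).lst p)) :
    Received (replaySchedule hD) p ((run a pg D j).lst p) (run a pg D j).time
      (∫⁻ θ in Ico (D.pos p ((run a pg D j).fst p)) ((run a pg D j).coord p),
        (D.v (unclock (D.φ p) θ) : ℝ≥0∞)) := by
  induction j with
  | zero => exact absurd (hp.trans_eq (Trace.pos_zero p)) (lt_irrefl (0 : ℝ))
  | succ j ih =>
    have htime := (time_strictMono hD (Nat.lt_succ_self j)).le
    rcases hr : pick a pg D (run a pg D j) with _ | r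
    · have e : run a pg D (j + 1) = { run a pg D j with time := nextTime D (run a pg D j).time } :=
        step_none hr
      have e1 : (run a pg D (j + 1)).coord = (run a pg D j).coord := by rw [e]
      have e2 : (run a pg D (j + 1)).lst = (run a pg D j).lst := by rw [e]
      have e3 : (run a pg D (j + 1)).fst = (run a pg D j).fst := by rw [e]
      rw [e1, e2] at hp
      rw [e1, e2, e3]
      exact (ih hp).mono le_rfl htime
    · by_cases hpr : p = pg r
      · subst hpr
        exact received_step hD hr ih
      · obtain ⟨h1, h2, h3, h4, h5, h6, h7, h8⟩ := start_spec hD (inv_run hD j) hr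
        obtain ⟨g1, g2, g3, g4, g5, g6, g7, g8⟩ := advance_spec hD h1 h7
        have e : run a pg D (j + 1) = advance D (start a pg D (run a pg D j) r) (pg r) :=
          step_some hr
        rw [← e] at g4 g5 g7
        obtain ⟨k1, k2, k3⟩ := h5 p hpr
        rw [(g7 p hpr).1, g5, k1, k3] at hp
        rw [(g7 p hpr).1, g4, g5, k1, k2, k3]
        exact (ih hp).mono le_rfl htime

/-- A window is replayed entirely after the real time `lst` at which it ends, so one broadcast
delivers the whole page to every request that arrived by `lst`, including those that arrived inside
the window. -/
theorem received_of_le_served (hD : D.Valid a pg σ lam) (j : ℕ) (p : Fin n) {x : ℝ} (hx : 0 ≤ x)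
    (h : x ≤ (run a pg D j).served p) :
    Received (replaySchedule hD) p x (run a pg D j).time (σ p) := by
  induction j with
  | zero =>
    have : x ≤ -1 := h
    linarith
  | succ j ih =>
    have htime := (time_strictMono hD (Nat.lt_succ_self j)).le
    rcases hr : pick a pg D (run a pg D j) with _ | r
    · have e : run a pg D (j + 1) = { run a pg D j with time := nextTime D (run a pg D j).time } :=
        step_none hr
      have e1 : (run a pg D (j + 1)).served = (run a pg D j).served := by rw [e]
      rw [e1] at h
      exact (ih h).mono le_rfl htime
    · obtain ⟨h1, h2, h3, h4, h5, h6, h7, h8⟩ := start_spec hD (inv_run hD j) hr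
      obtain ⟨g1, g2, g3, g4, g5, g6, g7, g8⟩ := advance_spec hD h1 h7
      have hstep := received_step hD hr (received_window hD j (pg r))
      have e : run a pg D (j + 1) = advance D (start a pg D (run a pg D j) r) (pg r) :=
        step_some hr
      rw [← e] at g4 g5 g7 g8
      by_cases hpr : p = pg r
      · subst hpr
        rcases g8 with ⟨k1, k2⟩ | ⟨-, k2, -⟩
        · rw [g4, g5, k1, lintegral_window hD h1 h7] at hstep
          exact hstep.mono (h.trans_eq k2) le_rfl
        · rw [k2, h3] at h
          exact (ih h).mono le_rfl htime
      · rw [(g7 p hpr).2, h3] at h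
        exact (ih h).mono le_rfl htime

/-- The energy of the integral schedule is at most that of the fractional schedule. -/
theorem lintegral_speed_le (hD : D.Valid a pg σ lam) {e : ℝ≥0 → ℝ≥0∞} (he : Measurable e)
    (he0 : e 0 = 0) :
    ∫⁻ t in Ici 0, e ((replaySchedule hD).speed t) ≤ ∫⁻ t in Ici 0, e (D.v t) := by
  -- Since coordinates never decrease, each point of a clock is replayed at most once; points that
  -- are skipped only help.
  have key : ∀ j, ∫⁻ t in Ico 0 (run a pg D j).time, e ((replaySchedule hD).speed t) ≤
      ∑ p, ∫⁻ θ in Ico 0 ((run a pg D j).coord p), e (D.v (unclock (D.φ p) θ)) := by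
    intro j
    induction j with
    | zero =>
      have : (run a pg D 0).time = 0 := rfl
      rw [this, Ico_self]
      simp
    | succ j ih =>
      have htime : (run a pg D j).time ≤ (run a pg D (j + 1)).time :=
        (time_strictMono hD (Nat.lt_succ_self j)).le
      rw [← lintegral_Ico_add _ (inv_run hD j).time_nonneg htime]
      rcases hr : pick a pg D (run a pg D j) with _ | r
      · have e' : run a pg D (j + 1) =
            { run a pg D j with time := nextTime D (run a pg D j).time } := step_none hr
        have e1 : (run a pg D (j + 1)).coord = (run a pg D j).coord := by rw [e']
        have h0 : ∫⁻ t in Ico (run a pg D j).time (run a pg D (j + 1)).time,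
            e ((replaySchedule hD).speed t) = 0 := by
          rw [setLIntegral_congr_fun (g := fun _ => 0) measurableSet_Ico, lintegral_zero]
          intro t ht
          have : (replaySchedule hD).speed t = 0 := by
            show outSpeed a pg D (run a pg D (idx a pg D t)) t = 0
            rw [idx_eq hD ht]
            simp only [outSpeed, hr]
          simp only [this, he0]
        rw [e1]
        refine (add_le_add ih h0.le).trans_eq (add_zero _)
      · obtain ⟨h1, h2, h3, h4, h5, h6, h7, h8⟩ := start_spec hD (inv_run hD j) hr
        obtain ⟨g1, g2, g3, g4, g5, g6, g7, g8⟩ := advance_spec hD h1 h7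
        have e' : run a pg D (j + 1) = advance D (start a pg D (run a pg D j) r) (pg r) :=
          step_some hr
        rw [← e'] at g2 g6 g7
        rw [h2] at g6
        have h0 : ∫⁻ t in Ico (run a pg D j).time (run a pg D (j + 1)).time,
            e ((replaySchedule hD).speed t) = ∫⁻ θ in Ico
              ((start a pg D (run a pg D j) r).coord (pg r)) ((run a pg D (j + 1)).coord (pg r)),
              e (D.v (unclock (D.φ (pg r)) θ)) := by
          rw [g6, ← lintegral_Ico_translate]
          refine setLIntegral_congr_fun measurableSet_Ico fun t ht => ?_
          show e (outSpeed a pg D (run a pg D (idx a pg D t)) t) = _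
          rw [idx_eq hD ht]
          simp only [outSpeed, hr]
        rw [← Finset.add_sum_erase _ _ (Finset.mem_univ (pg r))] at ih
        rw [h0, ← Finset.add_sum_erase _ _ (Finset.mem_univ (pg r))]
        have hsum : ∑ p ∈ Finset.univ.erase (pg r),
            ∫⁻ θ in Ico 0 ((run a pg D (j + 1)).coord p), e (D.v (unclock (D.φ p) θ)) =
            ∑ p ∈ Finset.univ.erase (pg r),
            ∫⁻ θ in Ico 0 ((run a pg D j).coord p), e (D.v (unclock (D.φ p) θ)) := by
          refine Finset.sum_congr rfl fun p hp => ?_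
          have hpr := Finset.ne_of_mem_erase hp
          rw [(g7 p hpr).1, (h5 p hpr).1]
        rw [hsum]
        have hle : (start a pg D (run a pg D j) r).coord (pg r) ≤
            (run a pg D (j + 1)).coord (pg r) := by
          rw [g6]
          linarith
        calc _ ≤ ((∫⁻ θ in Ico 0 ((run a pg D j).coord (pg r)), e (D.v (unclock (D.φ (pg r)) θ))) +
              ∫⁻ θ in Ico ((start a pg D (run a pg D j) r).coord (pg r))
                ((run a pg D (j + 1)).coord (pg r)), e (D.v (unclock (D.φ (pg r)) θ))) +
              ∑ p ∈ Finset.univ.erase (pg r),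
              ∫⁻ θ in Ico 0 ((run a pg D j).coord p), e (D.v (unclock (D.φ p) θ)) := by
              rw [add_right_comm]
              gcongr
          _ ≤ _ := by
              gcongr
              rw [← lintegral_Ico_add _ (h1.coord_nonneg (pg r)) hle]
              gcongr
              exact h4 (pg r)
  have hbound : ∀ j, ∫⁻ t in Ico 0 (run a pg D j).time, e ((replaySchedule hD).speed t) ≤
      ∫⁻ t in Ici 0, e (D.v t) := by
    intro j
    have h0 := (inv_run hD j).time_nonneg
    have hem : Measurable fun t => e (D.v t) := he.comp hD.measurable_rate
    calc _ ≤ _ := key j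
      -- Back in real time, page `p` pays for its share of each moment, and the shares add up to at
      -- most one.
      _ ≤ ∑ p, ∫⁻ t in Ico 0 (run a pg D j).time, (D.φ p t : ℝ≥0∞) * e (D.v t) := by
        refine Finset.sum_le_sum fun p _ => ?_
        rw [← lintegral_comp_unclock (hD.measurable_share p) (hD.share_le_one p) le_rfl h0 hem,
          clock_zero]
        exact lintegral_mono_set (Ico_subset_Ico_right ((inv_run hD j).coord_le p))
      _ = ∫⁻ t in Ico 0 (run a pg D j).time, ∑ p, (D.φ p t : ℝ≥0∞) * e (D.v t) := by
        rw [lintegral_finsetSum]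
        exact fun p _ => (hD.measurable_share p).coe_nnreal_ennreal.mul hem
      _ ≤ ∫⁻ t in Ico 0 (run a pg D j).time, e (D.v t) := by
        refine lintegral_mono fun t => ?_
        rw [← Finset.sum_mul]
        refine mul_le_of_le_one_left' ?_
        have := (hD.sum_le t).trans hD.lam_lt.le
        rw [← ENNReal.coe_le_one_iff] at this
        push_cast at this
        exact this
      _ ≤ _ := lintegral_mono_set Ico_subset_Ici_self
  have hU : Ici (0 : ℝ) = ⋃ j, Ico 0 (run a pg D j).time := by
    ext t
    simp only [mem_Ici, mem_iUnion, mem_Ico]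
    constructor
    · intro ht
      obtain ⟨j, hj⟩ := exists_lt_time hD t
      exact ⟨j, ht, hj⟩
    · rintro ⟨j, ht, -⟩
      exact ht
  have hdir : Directed (· ⊆ ·) fun j => Ico 0 (run a pg D j).time :=
    Monotone.directed_le fun i j h => Ico_subset_Ico_right ((time_strictMono hD).monotone h)
  rw [hU, setLIntegral_iUnion_of_directed _ hdir, ← hU]
  exact iSup_le hbound

end Output

/-! ### Causality of the replay -/

section Causal

variable {ι : Type*} {n : ℕ} {a : ι → ℝ} {pg : ι → Fin n} {D D' : Trace ι n}
  {σ : Fin n → ℝ≥0} {lam : ℝ≥0} {T : ℝ}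

variable (a D D' T) in
/-- The two fractional schedules cannot be distinguished by time `T`. -/
structure Agree : Prop where
  mem_iff : ∀ i, a i ≤ T → (i ∈ D.E ↔ i ∈ D'.E)
  b_eq : ∀ i ∈ D.E, a i ≤ T → (D.b i ≤ T ∨ D'.b i ≤ T) → D.b i = D'.b i
  share_eq : ∀ p t, t ≤ T → D.φ p t = D'.φ p t
  rate_eq : ∀ t, t ≤ T → D.v t = D'.v t

theorem Agree.symm (h : Agree a D D' T) : Agree a D' D T where
  mem_iff i hi := (h.mem_iff i hi).symm
  b_eq i hi ha hb := (h.b_eq i ((h.mem_iff i ha).2 hi) ha hb.symm).symm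
  share_eq p t ht := (h.share_eq p t ht).symm
  rate_eq t ht := (h.rate_eq t ht).symm

theorem Agree.pos_eq (h : Agree a D D' T) (hT : 0 ≤ T) (p : Fin n) {t : ℝ} (ht : t ≤ T) :
    D.pos p t = D'.pos p t := by
  refine intervalIntegral.integral_congr_uIoo fun u hu => ?_
  have : u ≤ T := hu.2.le.trans (max_le hT ht)
  simp only [h.share_eq p u this]

theorem Agree.mem_of_le (h : Agree a D D' T) (hD : D.Valid a pg σ lam) {i : ι} (hi : i ∈ D.E)
    (hb : D.b i ≤ T) : i ∈ D'.E ∧ D'.b i = D.b i := by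
  have ha := (hD.lt i hi).le.trans hb
  exact ⟨(h.mem_iff i ha).1 hi, (h.b_eq i hi ha (Or.inl hb)).symm⟩

theorem Agree.nextTime_le (h : Agree a D D' T) (hD : D.Valid a pg σ lam) {t : ℝ}
    (hn : nextTime D t ≤ T) : nextTime D' t ≤ nextTime D t := by
  classical
  rcases nextTime_eq (D := D) t with h1 | ⟨i, hi, h1, h2⟩
  · rw [h1]
    exact Finset.min'_le _ _ (Finset.mem_insert_self _ _)
  · rw [h2] at hn ⊢
    obtain ⟨h3, h4⟩ := h.mem_of_le hD hi hn
    rw [← h4] at h1 ⊢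
    exact Broadcast.nextTime_le h3 h1

theorem Agree.nextTime_eq (h : Agree a D D' T) (hD : D.Valid a pg σ lam)
    (hD' : D'.Valid a pg σ lam) {t : ℝ} (hn : nextTime D t ≤ T ∨ nextTime D' t ≤ T) :
    nextTime D t = nextTime D' t := by
  rcases hn with hn | hn
  · have h1 := h.nextTime_le hD hn
    exact le_antisymm (h.symm.nextTime_le hD' (h1.trans hn)) h1
  · have h1 := h.symm.nextTime_le hD' hn
    exact le_antisymm h1 (h.nextTime_le hD (h1.trans hn))

theorem Agree.queue_subset (h : Agree a D D' T) (hD : D.Valid a pg σ lam) {s : ReplayState n}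
    (hs : s.time ≤ T) : queue a pg D s ⊆ queue a pg D' s := by
  intro i hi
  obtain ⟨h1, h2, h3⟩ := mem_queue.1 hi
  obtain ⟨h4, h5⟩ := h.mem_of_le hD h1 (h2.trans hs)
  exact mem_queue.2 ⟨h4, h5 ▸ h2, h3⟩

theorem Agree.pick_eq (h : Agree a D D' T) (hD : D.Valid a pg σ lam)
    (hD' : D'.Valid a pg σ lam) {s : ReplayState n} (hs : s.time ≤ T) :
    pick a pg D s = pick a pg D' s := by
  classical
  have hq : queue a pg D s = queue a pg D' s :=
    (h.queue_subset hD hs).antisymm (h.symm.queue_subset hD' hs)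
  unfold pick
  rw [hq]
  congr 1
  ext i
  by_cases hi : i ∈ queue a pg D' s
  · have hi' := hi
    rw [← hq] at hi'
    obtain ⟨h1, h2, -⟩ := mem_queue.1 hi'
    rw [if_pos hi, if_pos hi, (h.mem_of_le hD h1 (h2.trans hs)).2]
  · rw [if_neg hi, if_neg hi]

theorem Agree.start_eq (h : Agree a D D' T) (hD : D.Valid a pg σ lam) (hT : 0 ≤ T)
    {s : ReplayState n} (hs : s.time ≤ T) (hI : Inv a pg D s) {r : ι}
    (hr : pick a pg D s = some r) : start a pg D s r = start a pg D' s r := by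
  obtain ⟨⟨hrE, hrb, -⟩, -⟩ := pick_eq_some hr
  have h1 := h.mem_of_le hD hrE (hrb.trans hs)
  unfold start
  rw [h.pos_eq hT _ ((hD.lt r hrE).le.trans (hrb.trans hs)),
    h.pos_eq hT _ ((hI.lst_le (pg r)).trans hs), h1.2]

/-- The next completions may differ only if both are after `T`; then a step that ends by `T` ends
with its broadcast, whose end is the same in both traces. -/
theorem Agree.advance_eq (h : Agree a D D' T) (hD : D.Valid a pg σ lam)
    (hD' : D'.Valid a pg σ lam) (hT : 0 ≤ T) {s : ReplayState n} (hs : s.time ≤ T)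
    (hI : Inv a pg D s) (p : Fin n)
    (hle : (advance D s p).time ≤ T ∨ (advance D' s p).time ≤ T) :
    advance D s p = advance D' s p := by
  have hp := h.pos_eq hT p ((hI.lst_le p).trans hs)
  by_cases hn : nextTime D s.time ≤ T ∨ nextTime D' s.time ≤ T
  · unfold advance
    rw [hp, h.nextTime_eq hD hD' hn]
  · rw [not_or, not_le, not_le] at hn
    by_cases hX : s.time + (D'.pos p (s.lst p) - s.coord p) ≤ T
    · unfold advance
      rw [hp, if_pos (hX.trans hn.1.le), if_pos (hX.trans hn.2.le)]
    · exfalso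
      unfold advance at hle
      rw [hp] at hle
      rcases hle with hle | hle
      · split_ifs at hle
        · exact hX hle
        · exact absurd hn.1 (not_lt.2 hle)
      · split_ifs at hle
        · exact hX hle
        · exact absurd hn.2 (not_lt.2 hle)

theorem Agree.step_eq (h : Agree a D D' T) (hD : D.Valid a pg σ lam)
    (hD' : D'.Valid a pg σ lam) (hT : 0 ≤ T) {s : ReplayState n} (hs : s.time ≤ T)
    (hI : Inv a pg D s)
    (hle : (step a pg D s).time ≤ T ∨ (step a pg D' s).time ≤ T) :
    step a pg D s = step a pg D' s := by
  have hpick := h.pick_eq (pg := pg) hD hD' hs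
  rcases hr : pick a pg D s with _ | r
  · rw [step_none hr, step_none (hpick ▸ hr)] at hle ⊢
    rw [h.nextTime_eq hD hD' hle]
  · have hst := h.start_eq hD hT hs hI hr
    rw [step_some hr, step_some (hpick ▸ hr), ← hst] at hle ⊢
    obtain ⟨h1, h2, -⟩ := start_spec hD hI hr
    exact h.advance_eq hD hD' hT (h2.trans_le hs) h1 _ hle

theorem Agree.run_eq (h : Agree a D D' T) (hD : D.Valid a pg σ lam)
    (hD' : D'.Valid a pg σ lam) (hT : 0 ≤ T) (j : ℕ)
    (hj : (run a pg D j).time ≤ T ∨ (run a pg D' j).time ≤ T) :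
    run a pg D j = run a pg D' j := by
  induction j with
  | zero => rfl
  | succ j ih =>
    have ih' := ih (hj.imp (time_strictMono hD (Nat.lt_succ_self j)).le.trans
      (time_strictMono hD' (Nat.lt_succ_self j)).le.trans)
    have hjT : (run a pg D j).time ≤ T := by
      rcases hj with hj | hj
      · exact (time_strictMono hD (Nat.lt_succ_self j)).le.trans hj
      · rw [ih']
        exact (time_strictMono hD' (Nat.lt_succ_self j)).le.trans hj
    have hj' : (step a pg D (run a pg D j)).time ≤ T ∨
        (step a pg D' (run a pg D j)).time ≤ T := by
      rcases hj with hj | hj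
      · exact Or.inl hj
      · right
        rw [ih']
        exact hj
    show step a pg D (run a pg D j) = step a pg D' (run a pg D' j)
    rw [← ih']
    exact h.step_eq hD hD' hT hjT (inv_run hD j) hj'

theorem Agree.idx_eq (h : Agree a D D' T) (hD : D.Valid a pg σ lam)
    (hD' : D'.Valid a pg σ lam) (hT : 0 ≤ T) : idx a pg D T = idx a pg D' T := by
  unfold idx
  congr 1
  ext j
  simp only [mem_ofPred_eq, ← not_le]
  rw [not_iff_not]
  constructor
  · intro hj
    rw [← h.run_eq hD hD' hT (j + 1) (Or.inl hj)]
    exact hj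
  · intro hj
    rw [h.run_eq hD hD' hT (j + 1) (Or.inr hj)]
    exact hj

theorem Agree.unclock_le (h : Agree a D D' T) (hD : D.Valid a pg σ lam) (hT : 0 ≤ T) (p : Fin n)
    {θ : ℝ} (hθ : θ ≤ D.pos p T) : unclock (D.φ p) θ ≤ T ∧
      unclock (D'.φ p) θ ≤ unclock (D.φ p) θ := by
  have h1 : unclock (D.φ p) θ ≤ T := Broadcast.unclock_le θ hT hθ
  refine ⟨h1, Broadcast.unclock_le θ (unclock_nonneg θ) ?_⟩
  have h2 := (unclock_le_iff (hD.measurable_share p) (hD.share_le_one p) hT hθ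
    (unclock_nonneg θ)).1 le_rfl
  exact h2.trans_eq (h.pos_eq hT p h1)

/-- The inverse clock at a point reached by `T` is decided by the shares up to `T`; each trace's
inverse bounds the other's. -/
theorem Agree.replay_eq (h : Agree a D D' T) (hD : D.Valid a pg σ lam)
    (hD' : D'.Valid a pg σ lam) (hT : 0 ≤ T) (p : Fin n) {θ : ℝ} (hθ : θ ≤ D.pos p T) :
    D.v (unclock (D.φ p) θ) = D'.v (unclock (D'.φ p) θ) := by
  have h1 := h.unclock_le hD hT p hθ
  have h2 := h.symm.unclock_le hD' hT p (hθ.trans_eq (h.pos_eq hT p le_rfl))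
  rw [le_antisymm h1.2 h2.2]
  exact h.rate_eq _ h1.1

theorem idle_of_neg (hD : D.Valid a pg σ lam) (hT : T < 0) :
    pick a pg D (run a pg D (idx a pg D T)) = none := by
  have h0 : idx a pg D T = 0 := by
    refine Nat.eq_zero_of_le_zero (Nat.sInf_le ?_)
    have : (run a pg D 0).time < (run a pg D 1).time := time_strictMono hD (Nat.lt_succ_self 0)
    exact hT.trans this
  rw [h0]
  rcases hr : pick a pg D (run a pg D 0) with _ | r
  · rfl
  · obtain ⟨⟨h1, h2, -⟩, -⟩ := pick_eq_some hr
    exact absurd (hD.b_pos h1) (not_lt.2 h2)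

/-- The integral schedule at time `T` depends only on the fractional schedule up to time `T`. -/
theorem Agree.replaySchedule_eq (h : Agree a D D' T) (hD : D.Valid a pg σ lam)
    (hD' : D'.Valid a pg σ lam) :
    (replaySchedule hD).page T = (replaySchedule hD').page T ∧
      (replaySchedule hD).pos T = (replaySchedule hD').pos T ∧
      (replaySchedule hD).speed T = (replaySchedule hD').speed T := by
  show outPage a pg D (run a pg D (idx a pg D T)) = outPage a pg D' (run a pg D' (idx a pg D' T)) ∧
    outPos a pg D (run a pg D (idx a pg D T)) T = outPos a pg D' (run a pg D' (idx a pg D' T)) T ∧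
    outSpeed a pg D (run a pg D (idx a pg D T)) T = outSpeed a pg D' (run a pg D' (idx a pg D' T)) T
  rcases lt_or_ge T 0 with hT | hT
  · simp only [outPage, outPos, outSpeed, idle_of_neg hD hT, idle_of_neg hD' hT, and_self]
  have htime := time_idx_le (a := a) (pg := pg) (D := D) hT
  have hlt := lt_time_idx hD T
  rw [← h.idx_eq hD hD' hT, ← h.run_eq hD hD' hT _ (Or.inl htime)]
  set s := run a pg D (idx a pg D T) with hs
  have hI : Inv a pg D s := inv_run hD _
  have hpick := h.pick_eq (pg := pg) hD hD' htime
  unfold outPage outPos outSpeed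
  rw [← hpick]
  rcases hr : pick a pg D s with _ | r
  · simp
  · have hst := h.start_eq hD hT htime hI hr
    simp only [← hst]
    obtain ⟨h1, h2, h3, h4, h5, h6, h7, h8⟩ := start_spec hD hI hr
    obtain ⟨g1, g2, g3, g4, g5, g6, g7, g8⟩ := advance_spec hD h1 h7
    have e : run a pg D (idx a pg D T + 1) = advance D (start a pg D s r) (pg r) := step_some hr
    rw [← e] at g6 g8
    have hlst : D.pos (pg r) ((start a pg D s r).lst (pg r)) ≤ D.pos (pg r) T :=
      hD.pos_mono _ ((h1.lst_le _).trans (h2.trans_le htime))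
    -- The point replayed at time `T` is within a window that has ended by `T`, so only the past of
    -- the fractional schedule is read.
    have hϑ : (start a pg D s r).coord (pg r) + (T - s.time) ≤ D.pos (pg r) T := by
      refine le_trans ?_ hlst
      rw [h2] at g6
      rcases g8 with g8 | g8
      · linarith [g8.1]
      · linarith [g8.1]
    have hfst : (start a pg D s r).fst (pg r) ≤ T := by
      obtain ⟨i, hi, -, hf, hl, -, -⟩ := h1.window _ h7
      have := (h1.lst_le (pg r)).trans (h2.trans_le htime)
      rw [hl] at this
      rw [hf]
      exact (hD.lt i hi).le.trans this
    refine ⟨trivial, ?_, h.replay_eq hD hD' hT _ hϑ⟩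
    rw [h.pos_eq hT _ hfst]
    congr 1
    refine setLIntegral_congr_fun measurableSet_Ico fun θ hθ => ?_
    simp only [h.replay_eq hD hD' hT (pg r) (hθ.2.le.trans hϑ)]

end Causal

/-! ### Copies of requests, ordered by arrival -/

section Requests

variable {n : ℕ}

/-- The arrival time of a request. -/
def arr (i : Request n × ℕ) : ℝ := i.1.arrival

/-- The page of a request. -/
def pageOf (i : Request n × ℕ) : Fin n := i.1.page

/-- Copies of requests are ordered by arrival time. -/
instance : LinearOrder (Request n × ℕ) :=
  LinearOrder.lift' (fun i => toLex (i.1.arrival, toLex (i.1.page, i.2))) <| by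
    rintro ⟨⟨p, x⟩, k⟩ ⟨⟨p', x'⟩, k'⟩ h
    have h1 := congrArg ofLex h
    simp only [ofLex_toLex, Prod.mk.injEq] at h1
    have h2 := congrArg ofLex h1.2
    simp only [ofLex_toLex, Prod.mk.injEq] at h2
    rw [h1.1, h2.1, h2.2]

theorem arr_mono : Monotone (arr (n := n)) := by
  intro i j h
  have h' : toLex (i.1.arrival, toLex (i.1.page, i.2)) ≤
    toLex (j.1.arrival, toLex (j.1.page, j.2)) := h
  rw [Prod.Lex.toLex_le_toLex] at h'
  rcases h' with h' | h'
  · exact_mod_cast h'.le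
  · exact_mod_cast h'.1.le

open Classical in
/-- The copies of requests in an instance. -/
def copies (I : Instance n) : Finset (Request n × ℕ) := I.toEnumFinset

theorem sum_map_eq (I : Instance n) (F : Request n → ℝ≥0∞) :
    (I.map F).sum = ∑ i ∈ copies I, F i.1 := by
  classical
  conv_lhs => rw [← Multiset.map_toEnumFinset_fst I]
  rw [Multiset.map_map]
  rfl

theorem mem_copies_iff {I J : Instance n} {T : ℝ} (h : I.known T = J.known T) (i : Request n × ℕ)
    (hi : arr i ≤ T) : i ∈ copies I ↔ i ∈ copies J := by
  classical
  unfold copies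
  rw [Multiset.mem_toEnumFinset, Multiset.mem_toEnumFinset]
  have h1 := congrArg (Multiset.count i.1) h
  unfold Instance.known at h1
  have e : ∀ K : Instance n, Multiset.count i.1 (Multiset.filter
      (fun r => (r.arrival : ℝ) ≤ T) K) = Multiset.count i.1 K := fun K =>
    Multiset.count_filter_of_pos (p := fun r : Request n => (r.arrival : ℝ) ≤ T) hi
  rw [e, e] at h1
  rw [h1]

end Requests

/-! ### Causality of the alive sets -/

section Alive

variable {ι : Type*} {n : ℕ} {a : ι → ℝ} {pg : ι → Fin n}

theorem alive_eq {σ : Fin n → ℝ} {rate : Finset ι → Fin n → ℝ} {E E' : Finset ι} {b b' : ι → ℝ}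
    {T : ℝ} (hb : IsCompletion a pg σ rate E b) (hb' : IsCompletion a pg σ rate E' b')
    (hE : ∀ i, a i ≤ T → (i ∈ E ↔ i ∈ E')) {t : ℝ} (ht : t ≤ T) :
    alive a E b t = alive a E' b' t := by
  ext i
  rw [mem_alive, mem_alive]
  by_cases hi : a i ≤ t
  · rw [hE i (hi.trans ht)]
    refine and_congr_right fun hiE => and_congr_right fun _ => ?_
    by_cases hc : b i ≤ T ∨ b' i ≤ T
    · rw [hb.eq_of_le hb' hE i ((hE i (hi.trans ht)).2 hiE) (hi.trans ht) hc]
    · rw [not_or, not_le, not_le] at hc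
      exact iff_of_true (ht.trans_lt hc.1) (ht.trans_lt hc.2)
  · simp [hi]

end Alive

/-! ### The fractional schedule as a trace -/

section Laps

variable {ι : Type*} [LinearOrder ι] {n : ℕ} (a : ι → ℝ) (pg : ι → Fin n) (β κ η : ℝ) (γ : ℕ → ℝ)

/-- The fractional schedule of a set of requests with given completion times, in which the time is
shared equally among the requests that have arrived last. -/
def laps (E : Finset ι) (b : ι → ℝ) : Trace ι n where
  E := E
  b := b
  -- The rate `κ * γ * frac` is written as the share `κ / η * frac` of the time at the higher rate
  -- `η * γ`, so the shares total at most `κ / η < 1`.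
  φ p t := (κ / η * frac β pg (alive a E b t) p).toNNReal
  v t := (η * γ (alive a E b t).card).toNNReal

variable {a pg β κ η γ}

theorem laps_valid (ha : ∀ i, 0 ≤ a i) {σ : Fin n → ℝ≥0} (hσ : ∀ p, 0 < σ p) (hκ : 0 ≤ κ)
    (hη : κ < η) (hγ : ∀ k, 0 ≤ γ k) {E : Finset ι} {b : ι → ℝ}
    (hb : IsCompletion a pg (fun p => (σ p : ℝ)) (fun A p => κ * γ A.card * frac β pg A p) E b) :
    (laps a pg β κ η γ E b).Valid a pg σ (κ / η).toNNReal where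
  nonneg := ha
  lt i hi := (hb i hi).1
  measurable_share p :=
    measurable_alive a E b fun A => (κ / η * frac β pg A p).toNNReal
  measurable_rate := measurable_alive a E b fun A => (η * γ A.card).toNNReal
  lam_lt := by
    rw [Real.toNNReal_lt_one]
    exact (div_lt_one (hκ.trans_lt hη)).2 hη
  sum_le t := by
    have h0 : 0 ≤ κ / η := div_nonneg hκ (hκ.trans_lt hη).le
    simp only [laps]
    rw [← Real.toNNReal_sum_of_nonneg fun p _ => mul_nonneg h0 (frac_nonneg _ _ _ _),
      ← Finset.mul_sum]
    exact Real.toNNReal_le_toNNReal (mul_le_of_le_one_right h0 (sum_frac_le _ _ _))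
  size_pos := hσ
  work i hi := by
    have hη0 : 0 < η := hκ.trans_lt hη
    have h := lintegral_rate hκ hγ hb hi
    rw [ENNReal.ofReal_coe_nnreal] at h
    rw [← h]
    refine lintegral_congr fun t => ?_
    change ENNReal.ofReal _ * ENNReal.ofReal _ = _
    rw [← ENNReal.ofReal_mul (mul_nonneg (div_nonneg hκ hη0.le) (frac_nonneg _ _ _ _))]
    congr 1
    field_simp

theorem laps_agree {σ : Fin n → ℝ} {rate : Finset ι → Fin n → ℝ} {E E' : Finset ι} {b b' : ι → ℝ}
    {T : ℝ} (hb : IsCompletion a pg σ rate E b) (hb' : IsCompletion a pg σ rate E' b')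
    (hE : ∀ i, a i ≤ T → (i ∈ E ↔ i ∈ E')) :
    Agree a (laps a pg β κ η γ E b) (laps a pg β κ η γ E' b') T where
  mem_iff := hE
  b_eq := hb.eq_of_le hb' hE
  share_eq p t ht := by
    simp only [laps, alive_eq hb hb' hE ht]
  rate_eq t ht := by
    simp only [laps, alive_eq hb hb' hE ht]

end Laps

/-! ### The competing schedule -/

section Opt

variable {n : ℕ} {D : Set ℝ} {P : ℝ → ℝ}

/-- The rate at which `S` sends page `p`. -/
def pageRate (S : Schedule n) (p : Fin n) : ℝ → ℝ≥0∞ :=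
  {t | S.page t = some p}.indicator fun t => (S.speed t : ℝ≥0∞)

theorem measurable_pageRate (S : Schedule n) (p : Fin n) : Measurable (pageRate S p) :=
  S.measurable_speed.coe_nnreal_ennreal.indicator (S.measurableSet_page p)

theorem sum_pageRate_le (S : Schedule n) (t : ℝ) : ∑ p, pageRate S p t ≤ S.speed t := by
  classical
  rcases h : S.page t with _ | q
  · have : ∀ p, pageRate S p t = 0 := fun p => by simp [pageRate, indicator, h]
    simp [this]
  · have : ∀ p, pageRate S p t = if q = p then (S.speed t : ℝ≥0∞) else 0 := fun p => by
      simp [pageRate, indicator, h]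
    simp [this]

theorem le_lintegral_pageRate {S : Schedule n} {σ : Fin n → ℝ≥0} {r : Request n} {f : ℝ}
    (h : S.SatisfiedBy σ r f) {t : ℝ} (ht : f ≤ t) :
    (σ r.page : ℝ≥0∞) ≤ ∫⁻ u in Icc (r.arrival : ℝ) t, pageRate S r.page u := by
  obtain ⟨R, h1, h2, h3, -, h5⟩ := h
  rw [← h5]
  have : ∫⁻ τ in R, (S.speed τ : ℝ≥0∞) = ∫⁻ τ in R, pageRate S r.page τ :=
    setLIntegral_congr_fun h1 fun τ hτ => by simp [pageRate, indicator, h3 τ hτ]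
  rw [this]
  exact lintegral_mono_set (h2.trans (Icc_subset_Icc_right ht))

/-- This bounds the charge term of `flow_le`, pointwise by `mul_div_speedOf_le`. Negative times
carry energy-free sending, but no request is alive then. -/
theorem lintegral_power_le (hP : IsPowerFunction D P) {S : Schedule n} (hS : S.Feasible D 1)
    {ι : Type*} {a : ι → ℝ} (ha : ∀ i, 0 ≤ a i) (E : Finset ι) (b : ι → ℝ) :
    ∫⁻ u, (∑ p, pageRate S p u) *
      ENNReal.ofReal ((alive a E b u).card / speedOf D P (alive a E b u).card) ≤
      ∑ i ∈ E, ENNReal.ofReal (b i - a i) + S.energy P 1 := by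
  have hm : Measurable fun t => ((alive a E b t).card : ℝ≥0∞) :=
    measurable_alive a E b fun A => (A.card : ℝ≥0∞)
  rw [← lintegral_card_alive, Schedule.energy, ← lintegral_indicator measurableSet_Ioi,
    ← lintegral_add_left hm]
  refine lintegral_mono_ae ?_
  have hne : ∀ᵐ u : ℝ, u ≠ 0 := by
    rw [ae_iff]
    simp
  filter_upwards [hne] with u hu
  have hs := hS u
  rw [div_one] at hs
  rcases lt_or_gt_of_ne hu with h | h
  · have : alive a E b u = ∅ := by
      ext i
      rw [mem_alive]
      simp only [Finset.notMem_empty, iff_false]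
      rintro ⟨-, h1, -⟩
      linarith [ha i]
    simp [this]
  · rw [indicator_of_mem (by exact h), div_one]
    calc _ ≤ (S.speed u : ℝ≥0∞) *
          ENNReal.ofReal ((alive a E b u).card / speedOf D P (alive a E b u).card) := by
          gcongr
          exact sum_pageRate_le S u
      _ = ENNReal.ofReal ((S.speed u : ℝ) *
          ((alive a E b u).card / speedOf D P (alive a E b u).card)) := by
          rw [ENNReal.ofReal_mul (NNReal.coe_nonneg (S.speed u)), ENNReal.ofReal_coe_nnreal]
      _ ≤ ENNReal.ofReal ((alive a E b u).card + P (S.speed u)) :=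
          ENNReal.ofReal_le_ofReal (mul_div_speedOf_le hP _ hs)
      _ = _ := by
          rw [ENNReal.ofReal_add (Nat.cast_nonneg _) (power_nonneg hP hs), ENNReal.ofReal_natCast]

/-- Flow time is an infimum that need not be attained, so a bound for actual satisfaction times is
carried over by approximation. -/
theorem sum_flowTime_add {ι : Type*} {E : Finset ι} {req : ι → Request n} {S : Schedule n}
    {σ : Fin n → ℝ≥0} {X Y : ℝ≥0∞} {K : ℝ}
    (h : ∀ f : ι → ℝ, (∀ i ∈ E, S.SatisfiedBy σ (req i) (f i)) →
      X ≤ ENNReal.ofReal K * (∑ i ∈ E, ENNReal.ofReal (f i - (req i).arrival) + Y)) (hK : 0 < K) :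
    X ≤ ENNReal.ofReal K * (∑ i ∈ E, S.flowTime σ (req i) + Y) := by
  classical
  by_cases htop : ∃ i ∈ E, S.flowTime σ (req i) = ⊤
  · obtain ⟨i, hi, htop⟩ := htop
    have : ∑ i ∈ E, S.flowTime σ (req i) = ⊤ := ENNReal.sum_eq_top.2 ⟨i, hi, htop⟩
    rw [this, top_add, ENNReal.mul_top (by simpa using hK)]
    exact le_top
  push Not at htop
  refine ENNReal.le_of_forall_pos_le_add fun δ hδ _ => ?_
  -- The errors of all requests together, multiplied by `K`, stay below `δ`; the `+ 1` covers empty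
  -- `E`.
  set δ' : ℝ := δ / (K * (E.card + 1)) with hδ'
  have hδ'0 : 0 < δ' := div_pos hδ (by positivity)
  have hex : ∀ i, ∃ x, i ∈ E → S.SatisfiedBy σ (req i) x ∧
      ENNReal.ofReal (x - (req i).arrival) ≤ S.flowTime σ (req i) + ENNReal.ofReal δ' := by
    intro i
    by_cases hi : i ∈ E
    · have h1 : S.flowTime σ (req i) < S.flowTime σ (req i) + ENNReal.ofReal δ' :=
        ENNReal.lt_add_right (htop i hi) (by simpa using hδ'0)
      conv at h1 => lhs; unfold Schedule.flowTime
      rw [iInf_lt_iff] at h1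
      obtain ⟨x, hx⟩ := h1
      rw [iInf_lt_iff] at hx
      obtain ⟨hx1, hx2⟩ := hx
      exact ⟨x, fun _ => ⟨hx1, hx2.le⟩⟩
    · exact ⟨0, fun h => absurd h hi⟩
  choose f hf using hex
  refine (h f fun i hi => (hf i hi).1).trans ?_
  calc _ ≤ ENNReal.ofReal K * (∑ i ∈ E, (S.flowTime σ (req i) + ENNReal.ofReal δ') + Y) := by
        gcongr with i hi
        exact (hf i hi).2
    _ = ENNReal.ofReal K * (∑ i ∈ E, S.flowTime σ (req i) + Y) +
        ENNReal.ofReal K * (E.card * ENNReal.ofReal δ') := by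
        rw [Finset.sum_add_distrib, Finset.sum_const, nsmul_eq_mul]
        ring
    _ ≤ _ := by
        gcongr
        rw [← ENNReal.ofReal_natCast, ← ENNReal.ofReal_mul (Nat.cast_nonneg _),
          ← ENNReal.ofReal_mul hK.le, ← ENNReal.ofReal_coe_nnreal]
        refine ENNReal.ofReal_le_ofReal ?_
        rw [hδ', mul_div_assoc', mul_div_assoc', div_le_iff₀ (by positivity)]
        have : (0 : ℝ) ≤ δ * K := by positivity
        nlinarith

end Opt

/-! ### Choice of parameters and the competitive ratio -/

section Main

variable {n : ℕ} {D : Set ℝ} {P : ℝ → ℝ} {σ : Fin n → ℝ≥0} {ε : ℝ}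

variable (D P ε) in
/-- The rates of the fractional schedule. -/
def lapsRate (A : Finset (Request n × ℕ)) (p : Fin n) : ℝ :=
  (1 + ε / 3) * speedOf D P A.card * frac (ε / 8) pageOf A p

theorem exists_completion (hP : IsPowerFunction D P) (h0 : 0 < ε) (h1 : ε ≤ 1)
    (hσ : ∀ p, 0 < σ p) (E : Finset (Request n × ℕ)) :
    ∃ b, IsCompletion arr pageOf (fun p => (σ p : ℝ)) (lapsRate D P ε) E b := by
  refine exists_isCompletion arr pageOf _ (fun p => by exact_mod_cast hσ p) _ (fun A p => ?_)
    (fun A hA => ?_) E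
  · exact mul_nonneg (mul_nonneg (by linarith) (speedOf_nonneg hP _)) (frac_nonneg _ _ _ _)
  · obtain ⟨i, hi, h⟩ := exists_frac_pos (β := ε / 8) (by linarith) (by linarith) pageOf hA
    exact ⟨i, hi, mul_pos (mul_pos (by linarith) (speedOf_pos hP hA.card_pos)) h⟩

theorem arr_nonneg (i : Request n × ℕ) : 0 ≤ arr i := i.1.arrival.2

/-- The fractional schedule against any schedule without speed advantage. -/
theorem fractional_flow_le (hP : IsPowerFunction D P) (h0 : 0 < ε) (h1 : ε ≤ 1)
    (hσ : ∀ p, 0 < σ p) {E : Finset (Request n × ℕ)} {b : Request n × ℕ → ℝ}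
    (hb : IsCompletion arr pageOf (fun p => (σ p : ℝ)) (lapsRate D P ε) E b)
    {S : Schedule n} (hS : S.Feasible D 1) :
    ∑ i ∈ E, ENNReal.ofReal (b i - arr i) ≤
      ENNReal.ofReal (64 / ε ^ 2) * (∑ i ∈ E, S.flowTime σ i.1 + S.energy P 1) := by
  refine sum_flowTime_add (req := Prod.fst) (fun f hf => ?_) (by positivity)
  have hflow := flow_le arr_mono (fun p => by exact_mod_cast hσ p) (β := ε / 8) (by linarith)
    (by linarith) (κ := 1 + ε / 3) (by linarith) (speedOf_nonneg hP) (fun k => speedOf_pos hP)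
    (speedOf_mono hP) (fun j k => div_speedOf_mono hP) hb f (pageRate S) (measurable_pageRate S)
    (fun i hi t ht => by
      rw [ENNReal.ofReal_coe_nnreal]
      exact le_lintegral_pageRate (hf i hi) ht)
  have hpow := lintegral_power_le hP hS arr_nonneg E b
  set X := ∑ i ∈ E, ENNReal.ofReal (b i - arr i) with hX
  set F := ∑ i ∈ E, ENNReal.ofReal (f i - arr i) with hF
  have hXtop : X ≠ ⊤ := by
    rw [hX]
    exact ENNReal.sum_ne_top.2 fun i _ => ENNReal.ofReal_ne_top
  -- The excess `ε / 6` over `1` survives when the term `X` coming from `lintegral_power_le` is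
  -- cancelled, which is possible because `X` is finite.
  have e1 : ENNReal.ofReal (1 + ε / 6) ≤ ENNReal.ofReal ((1 + ε / 3) * (1 - ε / 8)) :=
    ENNReal.ofReal_le_ofReal (by nlinarith)
  have e2 : ENNReal.ofReal ((1 + ε / 3) * (1 - ε / 8) / (ε / 8)) ≤ ENNReal.ofReal (32 / (3 * ε)) := by
    refine ENNReal.ofReal_le_ofReal ?_
    rw [div_le_div_iff₀ (by linarith) (by linarith)]
    nlinarith [mul_pos h0 h0]
  have e3 : (1 : ℝ≥0∞) ≤ ENNReal.ofReal (32 / (3 * ε)) := by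
    rw [ENNReal.one_le_ofReal, le_div_iff₀ (by linarith)]
    linarith
  have h2 : ENNReal.ofReal (1 + ε / 6) * X ≤
      X + ENNReal.ofReal (32 / (3 * ε)) * (F + S.energy P 1) := by
    calc _ ≤ _ := mul_le_mul_left e1 X
      _ ≤ _ := hflow
      _ ≤ ENNReal.ofReal (32 / (3 * ε)) * F + (X + 1 * S.energy P 1) := by
        rw [one_mul]
        gcongr
      _ ≤ ENNReal.ofReal (32 / (3 * ε)) * F + (X + ENNReal.ofReal (32 / (3 * ε)) * S.energy P 1) := by
        gcongr
      _ = _ := by ring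
  rw [ENNReal.ofReal_add zero_le_one (by linarith), ENNReal.ofReal_one, add_mul, one_mul,
    ENNReal.add_le_add_iff_left hXtop] at h2
  calc X = ENNReal.ofReal (6 / ε) * (ENNReal.ofReal (ε / 6) * X) := by
        rw [← mul_assoc, ← ENNReal.ofReal_mul (by positivity)]
        have : 6 / ε * (ε / 6) = 1 := by field_simp
        rw [this, ENNReal.ofReal_one, one_mul]
    _ ≤ ENNReal.ofReal (6 / ε) * (ENNReal.ofReal (32 / (3 * ε)) * (F + S.energy P 1)) := by gcongr
    _ = ENNReal.ofReal (64 / ε ^ 2) * (F + S.energy P 1) := by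
        rw [← mul_assoc, ← ENNReal.ofReal_mul (by positivity)]
        congr 2
        field_simp
        norm_num

theorem replay_valid (hP : IsPowerFunction D P) (h0 : 0 < ε)
    (hσ : ∀ p, 0 < σ p) {E : Finset (Request n × ℕ)} {b : Request n × ℕ → ℝ}
    (hb : IsCompletion arr pageOf (fun p => (σ p : ℝ)) (lapsRate D P ε) E b) :
    (laps arr pageOf (ε / 8) (1 + ε / 3) (1 + ε) (speedOf D P) E b).Valid arr pageOf σ
      ((1 + ε / 3) / (1 + ε)).toNNReal :=
  laps_valid arr_nonneg hσ (by linarith) (by linarith) (speedOf_nonneg hP) hb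

theorem replay_speed_eq {ι : Type*} {a : ι → ℝ} {pg : ι → Fin n} {T : Trace ι n} {lam : ℝ≥0}
    (hT : T.Valid a pg σ lam) (t : ℝ) :
    (replaySchedule hT).speed t = 0 ∨ ∃ x, (replaySchedule hT).speed t = T.v x := by
  show outSpeed a pg T (run a pg T (idx a pg T t)) t = 0 ∨
    ∃ x, outSpeed a pg T (run a pg T (idx a pg T t)) t = T.v x
  unfold outSpeed
  rcases pick a pg T (run a pg T (idx a pg T t)) with _ | r
  · exact Or.inl rfl
  · exact Or.inr ⟨_, rfl⟩

theorem replay_feasible (hP : IsPowerFunction D P) (h0 : 0 < ε)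
    (hσ : ∀ p, 0 < σ p) {E : Finset (Request n × ℕ)} {b : Request n × ℕ → ℝ}
    (hb : IsCompletion arr pageOf (fun p => (σ p : ℝ)) (lapsRate D P ε) E b) :
    (replaySchedule (replay_valid hP h0 hσ hb)).Feasible D (1 + ε) := by
  intro t
  rcases replay_speed_eq (replay_valid hP h0 hσ hb) t with h | ⟨x, h⟩
  · rw [h]
    simpa using hP.zero_mem
  · rw [h]
    simp only [laps]
    rw [Real.coe_toNNReal _ (mul_nonneg (by linarith) (speedOf_nonneg hP _)),
      mul_div_cancel_left₀ _ (by linarith)]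
    exact speedOf_mem hP _

theorem replay_flowTime_le (hP : IsPowerFunction D P) (h0 : 0 < ε) (h1 : ε ≤ 1)
    (hσ : ∀ p, 0 < σ p) {E : Finset (Request n × ℕ)} {b : Request n × ℕ → ℝ}
    (hb : IsCompletion arr pageOf (fun p => (σ p : ℝ)) (lapsRate D P ε) E b)
    {i : Request n × ℕ} (hi : i ∈ E) :
    (replaySchedule (replay_valid hP h0 hσ hb)).flowTime σ i.1 ≤
      ENNReal.ofReal (3 / ε) * ENNReal.ofReal (b i - arr i) := by
  have hT := replay_valid hP h0 hσ hb
  obtain ⟨j, hj1, hj2⟩ := exists_served hT hi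
  have hsat := (received_of_le_served hT j (pageOf i) (arr_nonneg i) hj1).satisfiedBy (r := i.1)
  refine (iInf₂_le _ hsat).trans ?_
  rw [← ENNReal.ofReal_mul (by positivity)]
  refine ENNReal.ofReal_le_ofReal ?_
  rw [Real.coe_toNNReal _ (div_nonneg (by linarith) (by linarith))] at hj2
  have hw : 0 < b i - arr i := sub_pos.2 (hb i hi).1
  -- The left side is `1 / (1 - lam) = 3 (1 + ε) / (2 ε)`.
  have e : 1 + (1 + ε / 3) / (1 + ε) / (1 - (1 + ε / 3) / (1 + ε)) ≤ 3 / ε := by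
    have e1 : 1 - (1 + ε / 3) / (1 + ε) = (2 * ε / 3) / (1 + ε) := by
      field_simp
      ring
    rw [e1, div_div_div_cancel_right₀ (by linarith), ← sub_nonneg]
    have : 3 / ε - (1 + (1 + ε / 3) / (2 * ε / 3)) = 3 * (1 - ε) / (2 * ε) := by
      field_simp
      ring
    rw [this]
    exact div_nonneg (by linarith) (by linarith)
  have := mul_le_mul_of_nonneg_right e hw.le
  change _ - arr i ≤ _
  change _ ≤ b i + _ * (b i - arr i) at hj2
  linarith

theorem replay_energy_le (hP : IsPowerFunction D P) (h0 : 0 < ε)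
    (hσ : ∀ p, 0 < σ p) {E : Finset (Request n × ℕ)} {b : Request n × ℕ → ℝ}
    (hb : IsCompletion arr pageOf (fun p => (σ p : ℝ)) (lapsRate D P ε) E b) :
    (replaySchedule (replay_valid hP h0 hσ hb)).energy P (1 + ε) ≤
      ∑ i ∈ E, ENNReal.ofReal (b i - arr i) := by
  classical
  have hT := replay_valid hP h0 hσ hb
  have hfeas := replay_feasible hP h0 hσ hb
  -- `P` is controlled only on `D`; the extension by `0` is measurable and agrees with `P` at all
  -- speeds in use.
  set e : ℝ≥0 → ℝ≥0∞ := fun x => ENNReal.ofReal (D.piecewise P (fun _ => 0) (x / (1 + ε))) with he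
  have hem : Measurable e := by
    have : Measurable (D.piecewise P fun _ => 0) :=
      hP.continuousOn.measurable_piecewise continuousOn_const hP.ordConnected.measurableSet
    exact (this.comp (measurable_coe_nnreal_real.div_const _)).ennreal_ofReal
  have he0 : e 0 = 0 := by
    simp [he, piecewise, hP.zero_mem, hP.map_zero]
  calc _ = ∫⁻ t in Ioi 0, e ((replaySchedule hT).speed t) := by
        refine lintegral_congr fun t => ?_
        simp only [he, piecewise_eq_of_mem D P _ (hfeas t)]
    _ ≤ ∫⁻ t in Ici 0, e ((replaySchedule hT).speed t) := lintegral_mono_set Ioi_subset_Ici_self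
    _ ≤ _ := lintegral_speed_le hT hem he0
    _ ≤ ∫⁻ t in Ici 0, ((alive arr E b t).card : ℝ≥0∞) := by
        refine lintegral_mono fun t => ?_
        simp only [he, laps]
        rw [Real.coe_toNNReal _ (mul_nonneg (by linarith) (speedOf_nonneg hP _)),
          mul_div_cancel_left₀ _ (by linarith), piecewise_eq_of_mem D P _ (speedOf_mem hP _)]
        rw [← ENNReal.ofReal_natCast]
        exact ENNReal.ofReal_le_ofReal (power_speedOf_le hP _)
    _ ≤ ∫⁻ t, ((alive arr E b t).card : ℝ≥0∞) := setLIntegral_le_lintegral _ _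
    _ = _ := lintegral_card_alive arr E b

end Main

end Broadcast
end

open Broadcast in
theorem mainTheorem2 :
    ∃ C : ℝ, 0 < C ∧
      ∀ ε : ℝ, 0 < ε → ε ≤ 1 →
      ∀ (D : Set ℝ) (P : ℝ → ℝ), IsPowerFunction D P →
      ∀ (n : ℕ) (σ : Fin n → ℝ≥0), (∀ p, 0 < σ p) →
        ∃ A : Algorithm n, A.IsOnline ∧ A.IsCompetitive D P σ (1 + ε) (C / ε ^ 3) := by
  -- `256 = 4 * 64`: the factor `4 / ε` for integral flow and energy against fractional flow, times
  -- `64 / ε ^ 2` for fractional flow against the optimum.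
  refine ⟨256, by norm_num, fun ε h0 h1 D P hP n σ hσ => ?_⟩
  choose b hb using fun I : Instance n => exists_completion hP h0 h1 hσ (copies I)
  refine ⟨fun I => replaySchedule (replay_valid hP h0 hσ (hb I)), fun I J t h => ?_, fun I => ?_⟩
  -- Completion times were chosen separately for each instance; their uniqueness up to time `t`
  -- makes the choices consistent.
  · exact (laps_agree (hb I) (hb J) (mem_copies_iff h)).replaySchedule_eq _ _
  · refine ⟨replay_feasible hP h0 hσ (hb I), ?_⟩
    have hc : ENNReal.ofReal (256 / ε ^ 3) ≠ 0 := by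
      rw [ne_eq, ENNReal.ofReal_eq_zero, not_le]
      positivity
    unfold optCost
    rw [ENNReal.mul_iInf_of_ne hc ENNReal.ofReal_ne_top]
    refine le_iInf fun S => ?_
    rw [ENNReal.mul_iInf_of_ne hc ENNReal.ofReal_ne_top]
    refine le_iInf fun hS => ?_
    unfold Schedule.cost
    rw [sum_map_eq, sum_map_eq]
    have hfrac := fractional_flow_le hP h0 h1 hσ (hb I) hS
    set X := ∑ i ∈ copies I, ENNReal.ofReal (b I i - arr i) with hX
    calc _ ≤ ∑ i ∈ copies I, ENNReal.ofReal (3 / ε) * ENNReal.ofReal (b I i - arr i) + X :=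
          add_le_add (Finset.sum_le_sum fun i hi => replay_flowTime_le hP h0 h1 hσ (hb I) hi)
            (replay_energy_le hP h0 hσ (hb I))
      _ = ENNReal.ofReal (3 / ε + 1) * X := by
          rw [← Finset.mul_sum, ENNReal.ofReal_add (by positivity) zero_le_one, ENNReal.ofReal_one,
            add_mul, one_mul]
      _ ≤ ENNReal.ofReal (4 / ε) * X := by
          refine mul_le_mul_left (ENNReal.ofReal_le_ofReal ?_) X
          rw [div_add_one h0.ne', div_le_div_iff_of_pos_right h0]
          linarith
      _ ≤ ENNReal.ofReal (4 / ε) * (ENNReal.ofReal (64 / ε ^ 2) *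
          (∑ i ∈ copies I, S.flowTime σ i.1 + S.energy P 1)) := by gcongr
      _ = _ := by
          rw [← mul_assoc, ← ENNReal.ofReal_mul (by positivity)]
          congr 2
          field_simp
          norm_num
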